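/- Let $\Omega$ be a standard Borel space, $G_0$ a finite measure on $\Omega$ (continuous, discrete or mixed), and $0<p<1$. Notation. $\mathrm{NB}(r,p)$ has probability mass function $\frac{\Gamma(r+m)}{m!\,\Gamma(r)}(1-p)^r p^m$, $m=0,1,2,\dots$ (for $r=0$ it is the point mass at $0$); $\mathrm{Log}(p)$ has probability mass function $-p^k/(k\ln(1-p))$, $k=1,2,\dots$; $\mathrm{CRT}(m,\gamma)$ is the law of $\sum_{n=1}^m b_n$ with independent $b_n\sim\mathrm{Bernoulli}\big(\gamma/(n-1+\gamma)\big)$, where $b_1=1$ also when $\gamma=0$, so that $\mathrm{CRT}(m,0)$ is the point mass at $\mathbf 1\{m>0\}$. All processes below are random measures on $\Omega$. * $L\sim\mathrm{PP}(\Lambda)$, for a finite measure $\Lambda$: the values of $L$ on disjoint measurable sets are independent, and $L(A)\sim\mathrm{Pois}(\Lambda(A))$ for each measurable $A\subset\Omega$. * $X\sim\mathrm{NBP}(G_0,p)$: the values of $X$ on disjoint measurable sets are independent, and $X(A)\sim\mathrm{NB}(G_0(A),p)$ for each measurable $A\subset\Omega$. * $X\sim\sum_{t=1}^{L}\mathrm{Log}(p)$: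 conditionally on $L$, $X=\sum_{\omega}X(\omega)\delta_\omega$, where $\omega$ runs over the atoms of $L$, the $X(\omega)$ are independent, and each $X(\omega)$ is a sum of $L(\omega)$ independent $\mathrm{Log}(p)$ variables. * $L\sim\mathrm{CRTP}(X,G_0)$: conditionally on $X$, $L=\sum_\omega L(\omega)\delta_\omega$, where $\omega$ runs over the atoms of $X$ and the $L(\omega)\sim\mathrm{CRT}(X(\omega),G_0(\{\omega\}))$ are independent. Claim. Consider the two constructions of a pair $(X,L)$ of random measures: $$\text{(a)}\quad X\sim\sum_{t=1}^{L}\mathrm{Log}(p),\quad L\sim\mathrm{PP}\big(-G_0\ln(1-p)\big);\qquad\qquad \text{(b)}\quad L\sim\mathrm{CRTP}(X,G_0),\quad X\sim\mathrm{NBP}(G_0,p).$$ Pairs as in (a) exist, and the two constructions are equivalent in distribution: a pair of random measures satisfies (a) if and only if it satisfies (b), and whenever $(X,L)$ satisfies (a) and $(X',L')$ satisfies (b), possibly on different probability spaces, $(X,L)$ and $(X',L')$ have the same joint distribution. In particular, $X$ in (a) is an $\mathrm{NBP}(G_0,p)$, and $L$ in (b) is a $\mathrm{PP}(-G_0\ln(1-p))$.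 -/

import Mathlib

open MeasureTheory ProbabilityTheory
open scoped ENNReal NNReal Nat

namespace NBProcess

/-! ### Distributions on `ℕ` -/

/-- The negative binomial distribution `NB(r, p)`, with probability mass function
`Γ(r + m) / (m! Γ(r)) * (1 - p) ^ r * p ^ m`; for `r = 0` it is the point mass at `0`. -/
noncomputable def nbMeasure (r : ℝ≥0) (p : Set.Ioo (0 : ℝ) 1) : Measure ℕ :=
  if r = 0 then Measure.dirac 0
  else Measure.sum fun m : ℕ =>
    ENNReal.ofReal (Real.Gamma (r + m) / (m ! * Real.Gamma r) * (1 - p : ℝ) ^ (r : ℝ) * (p : ℝ) ^ m) •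
      Measure.dirac m

/-- The logarithmic distribution `Log(p)`, with probability mass function
`- p ^ k / (k * log (1 - p))` for `k = 1, 2, …`. -/
noncomputable def logMeasure (p : Set.Ioo (0 : ℝ) 1) : Measure ℕ :=
  Measure.sum fun k : ℕ =>
    ENNReal.ofReal (-(p : ℝ) ^ (k + 1) / ((k + 1 : ℕ) * Real.log (1 - p))) • Measure.dirac (k + 1)

instance (p : Set.Ioo (0 : ℝ) 1) : IsProbabilityMeasure (logMeasure p) := by
  obtain ⟨p, hp0, hp1⟩ := p
  refine ⟨?_⟩
  have hlog : Real.log (1 - p) < 0 := Real.log_neg (by linarith) (by linarith)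
  have h := (Real.hasSum_pow_div_log_of_abs_lt_one (x := p)
    (by rw [abs_of_pos hp0]; exact hp1)).div_const (-Real.log (1 - p))
  rw [div_self (by linarith)] at h
  have h' : HasSum (fun k : ℕ => -p ^ (k + 1) / ((k + 1 : ℕ) * Real.log (1 - p))) 1 := by
    have e : (fun k : ℕ => -p ^ (k + 1) / ((k + 1 : ℕ) * Real.log (1 - p))) =
        fun k : ℕ => p ^ (k + 1) / (k + 1) / -Real.log (1 - p) := by
      funext k
      push_cast
      rw [div_div, mul_neg, div_neg, neg_div]
    rw [e]
    exact h
  have hnn : ∀ k : ℕ, 0 ≤ -p ^ (k + 1) / ((k + 1 : ℕ) * Real.log (1 - p)) := fun k =>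
    div_nonneg_of_nonpos (by have := pow_pos hp0 (k + 1); linarith)
      (mul_nonpos_of_nonneg_of_nonpos (by positivity) hlog.le)
  simp only [logMeasure, Measure.sum_apply _ MeasurableSet.univ, Measure.smul_apply,
    measure_univ, smul_eq_mul, mul_one]
  rw [← ENNReal.ofReal_tsum_of_nonneg hnn h'.summable, h'.tsum_eq, ENNReal.ofReal_one]

/-- The sum-logarithmic distribution: the law of `u₁ + ⋯ + u_l` with `u₁, …, u_l` independent and
`Log(p)`-distributed. -/
noncomputable def sumLogMeasure (p : Set.Ioo (0 : ℝ) 1) (l : ℕ) : Measure ℕ :=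
  (Measure.pi fun _ : Fin l => logMeasure p).map fun u => ∑ t, u t

instance (p : Set.Ioo (0 : ℝ) 1) (l : ℕ) : IsProbabilityMeasure (sumLogMeasure p l) :=
  Measure.isProbabilityMeasure_map (by fun_prop)

/-- The probability `γ / (n + γ)` that a customer who finds `n` customers already seated opens a
new table in a Chinese restaurant with concentration `γ`. The first customer (`n = 0`) always opens
a table, also when `γ = 0`. -/
noncomputable def newTableProb (γ : ℝ≥0) (n : ℕ) : unitInterval :=
  if n = 0 then 1
  else ⟨(γ : ℝ) / (n + γ), by positivity,
    div_le_one_of_le₀ (le_add_of_nonneg_left n.cast_nonneg) (by positivity)⟩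

/-- The Chinese restaurant table distribution `CRT(m, γ)`: the law of `b₁ + ⋯ + b_m`, with
independent `bₙ ∼ Bernoulli(γ / (n - 1 + γ))`. -/
noncomputable def crtMeasure (m : ℕ) (γ : ℝ≥0) : Measure ℕ :=
  (Measure.pi fun n : Fin m => bernoulliMeasure (1 : ℕ) 0 (newTableProb γ n)).map fun b => ∑ n, b n

instance (m : ℕ) (γ : ℝ≥0) : IsProbabilityMeasure (crtMeasure m γ) :=
  Measure.isProbabilityMeasure_map (by fun_prop)

/-! ### Random count measures -/

variable {Ω : Type*} [MeasurableSpace Ω] {S : Type*} [MeasurableSpace S]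

/-- `X` is a completely random measure on `Ω` whose value `X(A)` on each measurable set `A` has the
law `marg A` on `ℕ`: the values on disjoint sets are independent. -/
structure IsCompletelyRandom (X : S → Measure Ω) (marg : Set Ω → Measure ℕ) (P : Measure S) :
    Prop where
  measurable : Measurable X
  map_eval : ∀ A, MeasurableSet A → P.map (fun s => X s A) = (marg A).map (fun n : ℕ => (n : ℝ≥0∞))
  indep : ∀ (n : ℕ) (A : Fin n → Set Ω), (∀ i, MeasurableSet (A i)) →
    Pairwise (Function.onFun Disjoint A) → iIndepFun (fun i s => X s (A i)) P

/-- `X ∼ PP(Λ)`: Poisson process with finite mean measure `Λ`. -/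
def IsPoissonProcess (X : S → Measure Ω) (Λ : Measure Ω) (P : Measure S) : Prop :=
  IsCompletelyRandom X (fun A => poissonMeasure (Λ A).toNNReal) P

/-- `X ∼ NBP(G₀, p)`: negative binomial process with finite base measure `G₀`. -/
def IsNBProcess (X : S → Measure Ω) (G₀ : Measure Ω) (p : Set.Ioo (0 : ℝ) 1) (P : Measure S) :
    Prop :=
  IsCompletelyRandom X (fun A => nbMeasure (G₀ A).toNNReal p) P

/-- For a count measure `x = ∑ x(ω) δ_ω` on `Ω`, the law of the random measure `∑ Y(ω) δ_ω`, where
`ω` runs over the atoms of `x` and the counts `Y(ω)` are independent with `Y(ω) ∼ q ω (x(ω))`. -/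
noncomputable def atomwiseLaw (q : Ω → ℕ → Measure ℕ) [∀ ω n, IsProbabilityMeasure (q ω n)]
    (x : Measure Ω) : Measure (Measure Ω) :=
  (Measure.infinitePi fun ω : {ω : Ω // x {ω} ≠ 0} => q ω ⌊(x {ω.1}).toReal⌋₊).map
    fun y => Measure.sum fun ω => (y ω : ℝ≥0∞) • Measure.dirac ω.1

/-- The family of laws `κ x` is (a version of) the regular conditional distribution of `Y`
given `X = x`. -/
def HasCondLaw {𝓧 𝓨 : Type*} [MeasurableSpace 𝓧] [MeasurableSpace 𝓨] (Y : S → 𝓨) (X : S → 𝓧)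
    (κ : 𝓧 → Measure 𝓨) (P : Measure S) : Prop :=
  ∃ K : Kernel 𝓧 𝓨, (∀ᵐ x ∂(P.map X), K x = κ x) ∧ HasCondDistrib Y X K P

/-- `L ∼ CRTP(X, G₀)`: given `X`, `L(A) = ∑_{ω ∈ A} L(ω)` with independent
`L(ω) ∼ CRT(X(ω), G₀(ω))`. -/
def IsCRTP (L X : S → Measure Ω) (G₀ : Measure Ω) (P : Measure S) : Prop :=
  Measurable L ∧
    HasCondLaw L X (atomwiseLaw fun ω m => crtMeasure m (G₀ {ω}).toNNReal) P

/-- `X ∼ ∑_{t=1}^L Log(p)`: given `L`, `X(A) = ∑_{ω ∈ A} X(ω)`, where the `X(ω)` are independent and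
each `X(ω)` is a sum of `L(ω)` independent `Log(p)` variables. -/
def IsSumLog (X L : S → Measure Ω) (p : Set.Ioo (0 : ℝ) 1) (P : Measure S) : Prop :=
  Measurable X ∧ HasCondLaw X L (atomwiseLaw fun _ l => sumLogMeasure p l) P

/-- The compound Poisson construction: `X ∼ ∑_{t=1}^L Log(p)`, `L ∼ PP(-G₀ ln(1 - p))`. -/
def IsCompoundPoissonPair (X L : S → Measure Ω) (G₀ : Measure Ω) (p : Set.Ioo (0 : ℝ) 1)
    (P : Measure S) : Prop :=
  IsSumLog X L p P ∧ IsPoissonProcess L (ENNReal.ofReal (-Real.log (1 - p)) • G₀) P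

/-- The restaurant construction: `L ∼ CRTP(X, G₀)`, `X ∼ NBP(G₀, p)`. -/
def IsNBRestaurantPair (X L : S → Measure Ω) (G₀ : Measure Ω) (p : Set.Ioo (0 : ℝ) 1)
    (P : Measure S) : Prop :=
  IsCRTP L X G₀ P ∧ IsNBProcess X G₀ p P

end NBProcess

/-! Scatter a Poisson number of points over Ω with intensity -ln(1-p) G₀ and give each an
independent Log(p) mark (`restaurantSample`). Points are tables and marks are numbers of customers:
`tableMeasure` counts points, `customerMeasure` adds up marks. This single pair satisfies both (a)
and (b). Each description prescribes one marginal law and one conditional law, hence the joint law,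
so any pair satisfying either has the law of this one and therefore satisfies the other.

On one cell of mass r the claim is the identity Pois(-r ln(1-p)){l} · SumLog(l){m} = NB(r,p){m} ·
CRT(m,r){l} (`poisson_mul_sumLog_eq_nb_mul_crt`). With f = -log(1-pX), both sides equal (1-p)^r r^l
[X^m] f^l / l!. For the restaurant side this is an induction on m, driven by (1-pX) f' = p
(`nbReal_mul_crtMeasure`).

On a finite partition the cells are independent: the log-characteristic functional of a sum over a
Poisson sample is an integral against the intensity, hence additive over cells
(`map_regions_poissonSample`). The joint mass function of all cell counts is thus a product, and it
factors both ways.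

It remains to pass from cells to atoms (`hasCondLaw_atomwiseLaw`). Given the counts of one measure,
those of the other are independent over cells, with a law `Q` depending on the cell and its count.
Under refinement, cells containing atoms shrink to those atoms and the others carry nothing, so the
cell formula converges to the atomwise law. Its integral over a fixed event is the same joint
probability for every refinement, and dominated convergence identifies the limit. For SumLog, `Q`
does not depend on the cell. For CRT, the limit uses G₀(Aₙ) → G₀({ω}) and continuity of CRT(m,γ) in
γ, including at γ = 0, where the convention b₁ = 1 is essential. -/

namespace NBProcess

open Filter Topology Finset

/-! ### Sums of independent counts -/

/-- The law of a sum of `n + 1` independent counts, in terms of the sum of the first `n`. -/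
lemma pi_map_sum_succ_singleton {n : ℕ} (μ : Fin (n + 1) → Measure ℕ)
    [∀ i, IsProbabilityMeasure (μ i)] (k : ℕ) :
    ((Measure.pi μ).map fun u => ∑ i, u i) {k} = ∑ ij ∈ antidiagonal k,
      ((Measure.pi fun i : Fin n => μ i.castSucc).map fun u => ∑ i, u i) {ij.1} *
        μ (Fin.last n) {ij.2} := by
  have hmp := measurePreserving_piFinSuccAbove μ (Fin.last n)
  simp only [Fin.succAbove_last] at hmp
  rw [Measure.map_apply (by fun_prop) (measurableSet_singleton _)]
  have hset : (fun u : Fin (n + 1) → ℕ => ∑ i, u i) ⁻¹' {k} =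
      MeasurableEquiv.piFinSuccAbove (fun _ => ℕ) (Fin.last n) ⁻¹'
        (⋃ ij ∈ antidiagonal k, {ij.2} ×ˢ ((fun u : Fin n → ℕ => ∑ i, u i) ⁻¹' {ij.1})) := by
    ext u
    simp [Fin.sum_univ_castSucc, Fin.init]
  rw [hset, hmp.measure_preimage_equiv, measure_biUnion_finset]
  · refine sum_congr rfl fun ij _ => ?_
    rw [Measure.prod_prod, Measure.map_apply (by fun_prop) (measurableSet_singleton _), mul_comm]
  · intro x _ y _ hxy
    refine Set.disjoint_left.2 ?_
    rintro ⟨a, b⟩ h h'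
    simp only [Set.mem_prod, Set.mem_singleton_iff, Set.mem_preimage] at h h'
    exact hxy (Prod.ext (h.2.symm.trans h'.2) (h.1.symm.trans h'.1))
  · intro ij _
    exact (measurableSet_singleton _).prod ((by fun_prop : Measurable _) (measurableSet_singleton _))

lemma pi_map_sum_succ_real {n : ℕ} (μ : Fin (n + 1) → Measure ℕ)
    [∀ i, IsProbabilityMeasure (μ i)] (k : ℕ) :
    ((Measure.pi μ).map fun u => ∑ i, u i).real {k} = ∑ ij ∈ antidiagonal k,
      ((Measure.pi fun i : Fin n => μ i.castSucc).map fun u => ∑ i, u i).real {ij.1} *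
        (μ (Fin.last n)).real {ij.2} := by
  have : IsProbabilityMeasure ((Measure.pi fun i : Fin n => μ i.castSucc).map
      fun u => ∑ i, u i) := Measure.isProbabilityMeasure_map (by fun_prop)
  rw [measureReal_def, pi_map_sum_succ_singleton, ENNReal.toReal_sum]
  · simp [measureReal_def]
  · intro ij _
    exact ENNReal.mul_ne_top (measure_ne_top _ _) (measure_ne_top _ _)

/-! ### The Chinese restaurant table distribution -/

lemma crtMeasure_zero (γ : ℝ≥0) : crtMeasure 0 γ = Measure.dirac 0 := by
  simp [crtMeasure]

lemma crtMeasure_succ_real_zero (m : ℕ) (γ : ℝ≥0) :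
    (crtMeasure (m + 1) γ).real {0} = (1 - (newTableProb γ m : ℝ)) * (crtMeasure m γ).real {0} := by
  rw [crtMeasure, pi_map_sum_succ_real]
  simp [crtMeasure, bernoulliMeasure_real_apply, mul_comm]

/-- The last customer either joins a table or opens one, so only two terms of the convolution
survive. This Stirling-type recursion matches the one for the coefficients of powers of `logSeries`.
-/
lemma crtMeasure_succ_real_succ (m l : ℕ) (γ : ℝ≥0) :
    (crtMeasure (m + 1) γ).real {l + 1} = (1 - (newTableProb γ m : ℝ)) *
      (crtMeasure m γ).real {l + 1} + newTableProb γ m * (crtMeasure m γ).real {l} := by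
  rw [crtMeasure, pi_map_sum_succ_real,
    ← Finset.sum_subset (s₁ := {(l + 1, 0), (l, 1)})]
  · simp [crtMeasure, bernoulliMeasure_real_apply, mul_comm]
  · intro x
    simp only [mem_insert, mem_singleton, HasAntidiagonal.mem_antidiagonal]
    rintro (rfl | rfl) <;> simp
  · rintro ⟨i, j⟩ h h'
    have h0 : j ≠ 0 := by
      rintro rfl; exact h' (by simp_all)
    have h1 : j ≠ 1 := by
      rintro rfl; exact h' (by simp_all)
    simp [h0.symm, h1.symm]

/-- A division-free form of the definition. It also covers m = 0, where the convention gives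
probability 1 and both sides are γ, even for γ = 0. -/
lemma newTableProb_mul (γ : ℝ≥0) (m : ℕ) : ((m : ℝ) + γ) * newTableProb γ m = γ := by
  rcases eq_or_ne m 0 with rfl | hm
  · simp [newTableProb]
  · have : (0 : ℝ) < m := by positivity
    have h2 : (m : ℝ) + γ ≠ 0 := by positivity
    simp only [newTableProb, hm, if_false]
    field_simp

/-- The quotient γ/(m+γ) is singular only at m = γ = 0, and there the first-customer convention
makes the probability constantly 1. Continuity at γ = 0 is what allows diffuse parts of G₀. -/
lemma tendsto_newTableProb {ι : Type*} {f : Filter ι} {g : ι → ℝ≥0} {γ : ℝ≥0}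
    (hg : Tendsto g f (𝓝 γ)) (m : ℕ) :
    Tendsto (fun i => (newTableProb (g i) m : ℝ)) f (𝓝 (newTableProb γ m)) := by
  rcases eq_or_ne m 0 with rfl | hm
  · simp [newTableProb, tendsto_const_nhds]
  · have h0 : (0 : ℝ) < m := by positivity
    simp only [newTableProb, hm, if_false]
    have hg' : Tendsto (fun i => (g i : ℝ)) f (𝓝 (γ : ℝ)) := NNReal.tendsto_coe.2 hg
    exact hg'.div (tendsto_const_nhds.add hg') (by positivity)

lemma tendsto_crtMeasure_real {ι : Type*} {f : Filter ι} {g : ι → ℝ≥0} {γ : ℝ≥0}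
    (hg : Tendsto g f (𝓝 γ)) (m l : ℕ) :
    Tendsto (fun i => (crtMeasure m (g i)).real {l}) f (𝓝 ((crtMeasure m γ).real {l})) := by
  induction m generalizing l with
  | zero => simp [crtMeasure_zero, tendsto_const_nhds]
  | succ m ih =>
    have hq := tendsto_newTableProb hg m
    cases l with
    | zero =>
      simp only [crtMeasure_succ_real_zero]
      exact (tendsto_const_nhds.sub hq).mul (ih 0)
    | succ l =>
      simp only [crtMeasure_succ_real_succ]
      exact ((tendsto_const_nhds.sub hq).mul (ih _)).add (hq.mul (ih _))

lemma tendsto_crtMeasure {ι : Type*} {f : Filter ι} {g : ι → ℝ≥0} {γ : ℝ≥0}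
    (hg : Tendsto g f (𝓝 γ)) (m l : ℕ) :
    Tendsto (fun i => crtMeasure m (g i) {l}) f (𝓝 (crtMeasure m γ {l})) := by
  have := ENNReal.tendsto_ofReal (tendsto_crtMeasure_real hg m l)
  simpa using this

/-! ### Sums of logarithmic counts -/

/-- The power series `-log (1 - p X) = ∑ p ^ k / k X ^ k`. -/
noncomputable def logSeries (p : ℝ) : PowerSeries ℝ := PowerSeries.mk fun k => p ^ k / k

lemma logMeasure_real_singleton (p : Set.Ioo (0 : ℝ) 1) (k : ℕ) :
    (logMeasure p).real {k} = PowerSeries.coeff k (logSeries p) / (-Real.log (1 - p)) := by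
  obtain ⟨p, hp0, hp1⟩ := p
  have hlog : Real.log (1 - p) < 0 := Real.log_neg (by linarith) (by linarith)
  rw [measureReal_def, logMeasure, Measure.sum_apply _ (measurableSet_singleton _)]
  simp only [Measure.smul_apply, smul_eq_mul, measurableSet_singleton, Measure.dirac_apply',
    Set.indicator_apply, Set.mem_singleton_iff, logSeries, PowerSeries.coeff_mk]
  cases k with
  -- The constant coefficient of `logSeries` is p ^ 0 / 0, which is 0 by the convention on division,
  -- as required for a law on k ≥ 1.
  | zero => simp
  | succ k =>
    rw [tsum_eq_single k (by intro j hj; simp [hj])]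
    simp only [if_true, Pi.one_apply, mul_one]
    rw [ENNReal.toReal_ofReal]
    · push_cast
      rw [div_div, mul_neg, div_neg, neg_div]
    · exact div_nonneg_of_nonpos (by have := pow_pos hp0 (k + 1); linarith)
        (mul_nonpos_of_nonneg_of_nonpos (by positivity) hlog.le)

/-- Convolution of mass functions is multiplication of generating series. -/
lemma sumLogMeasure_real_singleton (p : Set.Ioo (0 : ℝ) 1) (l m : ℕ) :
    (sumLogMeasure p l).real {m} =
      PowerSeries.coeff m (logSeries p ^ l) / (-Real.log (1 - p)) ^ l := by
  induction l generalizing m with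
  | zero =>
    simp only [sumLogMeasure, Finset.univ_eq_empty, sum_empty, pow_zero, PowerSeries.coeff_one,
      div_one, Measure.map_const, measure_univ, one_smul]
    rw [measureReal_def, Measure.dirac_apply' _ (measurableSet_singleton _)]
    rcases eq_or_ne m 0 with rfl | h
    · simp
    · simp [h, h.symm]
  | succ l ih =>
    rw [sumLogMeasure, pi_map_sum_succ_real, pow_succ, PowerSeries.coeff_mul, pow_succ, sum_div]
    refine sum_congr rfl fun ij _ => ?_
    rw [← sumLogMeasure, ih, logMeasure_real_singleton, div_mul_div_comm]

lemma sumLogMeasure_zero (p : Set.Ioo (0 : ℝ) 1) : sumLogMeasure p 0 = Measure.dirac 0 := by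
  simp [sumLogMeasure]

/-- For f = `logSeries p`, the equation (1 - pX) f' = p gives (f^(l+1))' = pX (f^(l+1))' + p (l+1)
f^l. The recursion compares coefficients of X^m. -/
lemma coeff_succ_logSeries_pow_succ (p : ℝ) (l m : ℕ) :
    ((m : ℝ) + 1) * PowerSeries.coeff (m + 1) (logSeries p ^ (l + 1)) =
      p * (m * PowerSeries.coeff m (logSeries p ^ (l + 1)) +
        (l + 1) * PowerSeries.coeff m (logSeries p ^ l)) := by
  have hD : (1 - PowerSeries.C p * PowerSeries.X) * PowerSeries.derivative ℝ (logSeries p) =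
      PowerSeries.C p := by
    ext k
    rw [sub_mul, one_mul, mul_assoc, map_sub, PowerSeries.coeff_derivative, PowerSeries.coeff_C_mul]
    cases k with
    | zero => simp [logSeries]
    | succ k =>
      rw [PowerSeries.coeff_succ_X_mul, PowerSeries.coeff_derivative, PowerSeries.coeff_C]
      simp only [logSeries, PowerSeries.coeff_mk]
      have h1 : (k : ℝ) + 1 ≠ 0 := by positivity
      have h2 : (k : ℝ) + 1 + 1 ≠ 0 := by positivity
      push_cast
      field_simp
      simp [pow_succ]; ring
  have hP : PowerSeries.derivative ℝ (logSeries p ^ (l + 1)) =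
      PowerSeries.C p * (PowerSeries.X * PowerSeries.derivative ℝ (logSeries p ^ (l + 1))) +
        PowerSeries.C p * (PowerSeries.C ((l : ℝ) + 1) * logSeries p ^ l) := by
    have h := Derivation.leibniz_pow (PowerSeries.derivative ℝ) (logSeries p) (l + 1)
    simp only [Nat.add_sub_cancel, nsmul_eq_mul, smul_eq_mul] at h
    have hc : ((l + 1 : ℕ) : PowerSeries ℝ) = PowerSeries.C ((l : ℝ) + 1) := by simp
    rw [hc] at h
    rw [h]
    linear_combination (PowerSeries.C ((l : ℝ) + 1) * logSeries p ^ l) * hD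
  have h := congrArg (PowerSeries.coeff m) hP
  rw [map_add, PowerSeries.coeff_C_mul, PowerSeries.coeff_C_mul, PowerSeries.coeff_C_mul,
    PowerSeries.coeff_derivative] at h
  have hX : PowerSeries.coeff m (PowerSeries.X *
      PowerSeries.derivative ℝ (logSeries p ^ (l + 1))) =
      m * PowerSeries.coeff m (logSeries p ^ (l + 1)) := by
    cases m with
    | zero => simp
    | succ m =>
      rw [PowerSeries.coeff_succ_X_mul, PowerSeries.coeff_derivative]; push_cast; ring
  rw [hX] at h
  linear_combination h

/-! ### The two constructions on one point -/

/-- The negative binomial probability mass function. -/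
noncomputable def nbReal (r p : ℝ) (m : ℕ) : ℝ :=
  Real.Gamma (r + m) / (m ! * Real.Gamma r) * (1 - p) ^ r * p ^ m

lemma nbReal_succ {r : ℝ} (hr : 0 < r) (p : ℝ) (m : ℕ) :
    (m + 1) * nbReal r p (m + 1) = (m + r) * p * nbReal r p m := by
  have hG : Real.Gamma (r + (m + 1 : ℕ)) = (r + m) * Real.Gamma (r + m) := by
    rw [← Real.Gamma_add_one (by positivity)]; push_cast; ring_nf
  have h1 : (m : ℝ) + 1 ≠ 0 := by positivity
  have h2 : Real.Gamma r ≠ 0 := (Real.Gamma_pos_of_pos hr).ne'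
  have h3 : (m ! : ℝ) ≠ 0 := by positivity
  rw [nbReal, nbReal, hG, Nat.factorial_succ]
  push_cast
  field_simp
  ring

/-- Both sides satisfy (m+1) F(m+1, l+1) = p (m F(m, l+1) + r F(m, l)). On the left, `nbReal_succ`
supplies the factor (m+r) p, and (m+r) times the new-table probability is r, which leaves m for
joining a table. On the right it is the recursion for powers of `logSeries`. -/
lemma nbReal_mul_crtMeasure {r : ℝ≥0} (hr : r ≠ 0) (p : ℝ) (m l : ℕ) :
    nbReal r p m * (crtMeasure m r).real {l} =
      (1 - p) ^ (r : ℝ) * r ^ l * PowerSeries.coeff m (logSeries p ^ l) / l ! := by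
  have hr' : (0 : ℝ) < r := by positivity
  induction m generalizing l with
  | zero =>
    have h2 : Real.Gamma r ≠ 0 := (Real.Gamma_pos_of_pos hr').ne'
    rw [crtMeasure_zero, measureReal_def, Measure.dirac_apply' _ (measurableSet_singleton _)]
    cases l with
    | zero => simp [nbReal, h2]
    | succ l => simp [nbReal, logSeries, pow_succ]
  | succ m ih =>
    have hq := newTableProb_mul r m
    have hn := nbReal_succ hr' p m
    have h1 : (m : ℝ) + 1 ≠ 0 := by positivity
    refine mul_left_cancel₀ h1 ?_
    cases l with
    | zero =>
      have i0 := ih 0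
      rw [← mul_assoc, hn, crtMeasure_succ_real_zero]
      have : ((m : ℝ) + 1) * ((1 - p) ^ (r : ℝ) * (r : ℝ) ^ 0 *
          PowerSeries.coeff (m + 1) (logSeries p ^ 0) / (0)!) = 0 := by
        simp [PowerSeries.coeff_one]
      rw [this]
      -- With no tables, F(m, 0) is nonzero only at m = 0, where the factor m kills it; this makes
      -- the recursion consistent with F(m+1, 0) = 0.
      have hm : (m : ℝ) * PowerSeries.coeff m (logSeries p ^ 0) = 0 := by
        rcases eq_or_ne m 0 with rfl | h
        · simp
        · simp [PowerSeries.coeff_one, h]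
      simp only [pow_zero, Nat.factorial_zero, Nat.cast_one] at i0
      simp only [pow_zero] at hm
      linear_combination (-p * nbReal r p m * (crtMeasure m r).real {0}) * hq +
        (p * m) * i0 + p * (1 - p) ^ (r : ℝ) * hm
    | succ l =>
      have i0 := ih l
      have i1 := ih (l + 1)
      have hc := coeff_succ_logSeries_pow_succ p l m
      have h3 : (l ! : ℝ) ≠ 0 := by positivity
      have h4 : (l : ℝ) + 1 ≠ 0 := by positivity
      rw [← mul_assoc, hn, crtMeasure_succ_real_succ]
      have hrhs : ((m : ℝ) + 1) * ((1 - p) ^ (r : ℝ) * (r : ℝ) ^ (l + 1) *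
          PowerSeries.coeff (m + 1) (logSeries p ^ (l + 1)) / (l + 1)!) =
          p * (m * ((1 - p) ^ (r : ℝ) * (r : ℝ) ^ (l + 1) *
            PowerSeries.coeff m (logSeries p ^ (l + 1)) / (l + 1)!) +
          r * ((1 - p) ^ (r : ℝ) * (r : ℝ) ^ l *
            PowerSeries.coeff m (logSeries p ^ l) / l !)) := by
        rw [Nat.factorial_succ]
        push_cast
        field_simp
        linear_combination (1 - p) ^ (r : ℝ) * (r : ℝ) * (r : ℝ) ^ l * hc
      rw [hrhs, ← i0, ← i1]
      linear_combination (p * nbReal r p m * ((crtMeasure m r).real {l} -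
        (crtMeasure m r).real {l + 1})) * hq

/-- The rate `-log (1 - p)`. -/
noncomputable def logRate (p : Set.Ioo (0 : ℝ) 1) : ℝ≥0 := (-Real.log (1 - p)).toNNReal

lemma logRate_pos (p : Set.Ioo (0 : ℝ) 1) : 0 < -Real.log (1 - (p : ℝ)) := by
  have := Real.log_neg (sub_pos.2 p.2.2) (by linarith [p.2.1])
  linarith

lemma coe_logRate (p : Set.Ioo (0 : ℝ) 1) : (logRate p : ℝ) = -Real.log (1 - p) :=
  Real.coe_toNNReal _ (logRate_pos p).le

lemma nbReal_nonneg {r p : ℝ} (hr : 0 ≤ r) (hp : 0 ≤ p) (hp1 : p ≤ 1) (m : ℕ) :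
    0 ≤ nbReal r p m := by
  have h1 := Real.Gamma_nonneg_of_nonneg hr
  have h2 := Real.Gamma_nonneg_of_nonneg (add_nonneg hr m.cast_nonneg)
  have h3 := Real.rpow_nonneg (sub_nonneg.2 hp1) r
  unfold nbReal
  positivity

lemma nbMeasure_singleton {r : ℝ≥0} (hr : r ≠ 0) (p : Set.Ioo (0 : ℝ) 1) (m : ℕ) :
    nbMeasure r p {m} = ENNReal.ofReal (nbReal r p m) := by
  rw [nbMeasure, if_neg hr, Measure.sum_apply _ (measurableSet_singleton _), tsum_eq_single m]
  · simp [nbReal]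
  · intro j hj
    simp [hj]

/-- The joint mass function of the two constructions on one point. -/
lemma poisson_mul_sumLog_eq_nb_mul_crt (r : ℝ≥0) (p : Set.Ioo (0 : ℝ) 1) (m l : ℕ) :
    poissonMeasure (logRate p * r) {l} * sumLogMeasure p l {m} =
      nbMeasure r p {m} * crtMeasure m r {l} := by
  have hlog := logRate_pos p
  rw [poissonMeasure_singleton, ← ENNReal.ofReal_toReal (measure_ne_top (sumLogMeasure p l) {m}),
    ← measureReal_def, sumLogMeasure_real_singleton, ← ENNReal.ofReal_mul (by positivity)]
  -- For r = 0 both sides are the point mass at (0, 0); this case is separate because the Gamma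
  -- formula needs r > 0.
  rcases eq_or_ne r 0 with rfl | hr
  · rw [nbMeasure, if_pos rfl, Measure.dirac_apply' _ (measurableSet_singleton _)]
    cases m with
    | zero =>
      rw [crtMeasure_zero, Measure.dirac_apply' _ (measurableSet_singleton _)]
      cases l <;> simp
    | succ m =>
      cases l <;> simp
  · rw [nbMeasure_singleton hr, ← ENNReal.ofReal_toReal (measure_ne_top (crtMeasure m r) {l}),
      ← measureReal_def, ← ENNReal.ofReal_mul (nbReal_nonneg r.coe_nonneg p.2.1.le p.2.2.le m),
      nbReal_mul_crtMeasure hr]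
    congr 1
    -- The normalizations agree since exp(r ln(1-p)) = (1-p)^r; the l-th power of the rate in the
    -- Poisson mass then cancels the denominator of the sum-logarithmic mass.
    have h1 : Real.exp (-((logRate p * r : ℝ≥0) : ℝ)) = (1 - (p : ℝ)) ^ (r : ℝ) := by
      rw [Real.rpow_def_of_pos (sub_pos.2 p.2.2), NNReal.coe_mul, coe_logRate]
      congr 1; ring
    rw [h1, NNReal.coe_mul, coe_logRate, mul_pow]
    have : Real.log (1 - (p : ℝ)) ≠ 0 := by linarith
    field_simp

/-! ### Poisson samples -/

section PoissonSample

variable {Y : Type*} [MeasurableSpace Y]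

/-- Finite lists of points of `Y`. -/
abbrev Sample (Y : Type*) : Type _ := Σ n : ℕ, (Fin n → Y)

/-- The list with the given `n` entries. -/
abbrev Sample.of (n : ℕ) (y : Fin n → Y) : Sample Y := ⟨n, y⟩

lemma measurable_sample_of (n : ℕ) : Measurable (Sample.of n : (Fin n → Y) → Sample Y) :=
  fun _ hs => MeasurableSpace.measurableSet_iInf.1 hs n

lemma measurable_of_sample {Z : Type*} [MeasurableSpace Z] {f : Sample Y → Z}
    (h : ∀ n, Measurable fun y : Fin n → Y => f (Sample.of n y)) : Measurable f :=
  fun _ hs => MeasurableSpace.measurableSet_iInf.2 fun n => h n hs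

/-- The law of a list of points of `Y` whose length is Poisson with mean `ρ univ`, and whose entries
are independent with law proportional to `ρ`. -/
noncomputable def poissonSample (ρ : Measure Y) : Measure (Sample Y) :=
  Measure.sum fun n => ENNReal.ofReal (Real.exp (-(ρ.real Set.univ)) / n !) •
    (Measure.pi fun _ : Fin n => ρ).map (Sample.of n)

variable (ρ : Measure Y) [IsFiniteMeasure ρ]

/-- The n-fold product of the unnormalized ρ has mass ρ(Y)^n, so the weights exp(-ρ(Y))/n! produce
the Poisson masses. No division by ρ(Y) occurs, and ρ = 0 is allowed. -/
instance : IsProbabilityMeasure (poissonSample ρ) := by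
  refine ⟨?_⟩
  have h := hasSum_one_poissonMeasure (ρ Set.univ).toNNReal
  have e : ((ρ Set.univ).toNNReal : ℝ) = ρ.real Set.univ := rfl
  rw [e] at h
  have h0 : ∀ n : ℕ, 0 ≤ Real.exp (-(ρ.real Set.univ)) * ρ.real Set.univ ^ n / n ! :=
    fun n => by positivity
  rw [poissonSample, Measure.sum_apply _ MeasurableSet.univ, ← ENNReal.ofReal_one, ← h.tsum_eq,
    ENNReal.ofReal_tsum_of_nonneg h0 h.summable]
  refine tsum_congr fun n => ?_
  rw [Measure.smul_apply, Measure.map_apply (measurable_sample_of n) MeasurableSet.univ,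
    Set.preimage_univ, Measure.pi_univ, Finset.prod_const, Finset.card_univ, Fintype.card_fin,
    smul_eq_mul, mul_div_right_comm, ENNReal.ofReal_mul (by positivity),
    ENNReal.ofReal_pow measureReal_nonneg, ofReal_measureReal]

omit [IsFiniteMeasure ρ] in
lemma poissonSample_apply (s : Set (Sample Y)) (hs : MeasurableSet s) :
    poissonSample ρ s = ∑' n : ℕ, ENNReal.ofReal (Real.exp (-(ρ.real Set.univ)) / n !) *
      (Measure.pi fun _ : Fin n => ρ) (Sample.of n ⁻¹' s) := by
  rw [poissonSample, Measure.sum_apply _ hs]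
  simp only [Measure.smul_apply, smul_eq_mul, Measure.map_apply (measurable_sample_of _) hs]

/-- The probability generating functional of a Poisson sample: lists of length n contribute
exp(-ρ(Y)) (∫ g)^n / n!, and these terms sum to an exponential. The bound on g gives integrability.
-/
lemma integral_prod_poissonSample {g : Y → ℂ} (hg : Measurable g) (hg1 : ∀ y, ‖g y‖ ≤ 1) :
    ∫ s : Sample Y, ∏ k, g (s.2 k) ∂(poissonSample ρ) = Complex.exp (∫ y, (g y - 1) ∂ρ) := by
  have hm : Measurable fun s : Sample Y => ∏ k, g (s.2 k) :=
    measurable_of_sample fun n => by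
      change Measurable fun y : Fin n → Y => ∏ k, g (y k)
      fun_prop
  have hint : Integrable (fun s : Sample Y => ∏ k, g (s.2 k)) (poissonSample ρ) := by
    refine Integrable.of_bound hm.aestronglyMeasurable 1 (ae_of_all _ fun s => ?_)
    rw [norm_prod]
    exact prod_le_one (fun _ _ => norm_nonneg _) fun _ _ => hg1 _
  have hgi : Integrable g ρ := Integrable.of_bound hg.aestronglyMeasurable 1 (ae_of_all _ hg1)
  have hs := hasSum_integral_measure (f := fun s : Sample Y => ∏ k, g (s.2 k)) hint
  have hterm : ∀ n : ℕ, ∫ s : Sample Y, ∏ k, g (s.2 k)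
      ∂(ENNReal.ofReal (Real.exp (-(ρ.real Set.univ)) / n !) •
        (Measure.pi fun _ : Fin n => ρ).map (Sample.of n)) =
      Complex.exp (-(ρ.real Set.univ)) * ((∫ y, g y ∂ρ) ^ n / n !) := by
    intro n
    rw [integral_smul_measure, integral_map (measurable_sample_of n).aemeasurable
      hm.aestronglyMeasurable, integral_fintype_prod_eq_pow, Fintype.card_fin,
      ENNReal.toReal_ofReal (by positivity)]
    rw [Complex.real_smul]
    push_cast
    ring
  simp only [hterm] at hs
  have h2 := (NormedSpace.expSeries_div_hasSum_exp (∫ y, g y ∂ρ)).mul_left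
    (Complex.exp (-(ρ.real Set.univ)))
  rw [← Complex.exp_eq_exp_ℂ, ← Complex.exp_add] at h2
  rw [show poissonSample ρ = Measure.sum _ from rfl, hs.unique h2,
    integral_sub hgi (integrable_const _), integral_const]
  congr 1
  simp; ring

variable {E : Type*} [NormedAddCommGroup E] [NormedSpace ℝ E] [MeasurableSpace E] [BorelSpace E]
  [SecondCountableTopology E]

omit [NormedSpace ℝ E] in
lemma measurable_sum_sample {h : Y → E} (hh : Measurable h) :
    Measurable fun s : Sample Y => ∑ k, h (s.2 k) :=
  measurable_of_sample fun n => by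
    change Measurable fun y : Fin n → Y => ∑ k, h (y k)
    fun_prop

/-- The generating functional at g = exp(i L∘h). The exponent is linear in ρ, which is the source of
independence over disjoint regions. -/
lemma charFunDual_map_sum_poissonSample {h : Y → E} (hh : Measurable h) (L : StrongDual ℝ E) :
    charFunDual ((poissonSample ρ).map fun s => ∑ k, h (s.2 k)) L =
      Complex.exp (∫ y, (Complex.exp (L (h y) * Complex.I) - 1) ∂ρ) := by
  rw [charFunDual_apply, integral_map (measurable_sum_sample hh).aemeasurable
    (by fun_prop), ← integral_prod_poissonSample]
  · simp only [map_sum, Complex.ofReal_sum, Finset.sum_mul, Complex.exp_sum]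
  · fun_prop
  · intro y
    rw [Complex.norm_exp_ofReal_mul_I]

/-- The sums of a mark over the sample points in disjoint regions are independent, and the sum over
a region depends only on the intensity in that region. -/
lemma map_regions_poissonSample [CompleteSpace E] {κ : Type*} [Fintype κ] [DecidableEq κ]
    [MeasurableSpace κ] [MeasurableSingletonClass κ] {a : Y → κ} (ha : Measurable a) {h : Y → E}
    (hh : Measurable h) :
    (poissonSample ρ).map (fun s i => ∑ k, if a (s.2 k) = i then h (s.2 k) else 0) =
      Measure.pi fun i => (poissonSample (ρ.restrict (a ⁻¹' {i}))).map fun s => ∑ k, h (s.2 k) := by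
  have : ∀ i, IsProbabilityMeasure ((poissonSample (ρ.restrict (a ⁻¹' {i}))).map
      fun s => ∑ k, h (s.2 k)) := fun i =>
    Measure.isProbabilityMeasure_map (measurable_sum_sample hh).aemeasurable
  -- Placing h y in coordinate a y turns the family of regional sums into a single vector-valued sum
  -- over the sample, with one characteristic functional.
  have hm : Measurable fun y : Y => (Pi.single (a y) (h y) : κ → E) := by
    refine measurable_pi_iff.2 fun i => ?_
    have : (fun y => (Pi.single (a y) (h y) : κ → E) i) = (a ⁻¹' {i}).indicator h := by
      funext y
      by_cases hy : a y = i
      · subst hy; simp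
      · rw [Pi.single_eq_of_ne (Ne.symm hy), Set.indicator_of_notMem (by exact hy)]
    rw [this]
    exact hh.indicator (ha (measurableSet_singleton _))
  have hfun : (fun (s : Σ n : ℕ, (Fin n → Y)) (i : κ) =>
      ∑ k, if a (s.2 k) = i then h (s.2 k) else 0) =
      fun s => ∑ k, (Pi.single (a (s.2 k)) (h (s.2 k)) : κ → E) := by
    funext s i
    rw [Finset.sum_apply]
    refine sum_congr rfl fun k _ => ?_
    rw [Pi.single_apply]
    simp [eq_comm]
  rw [hfun]
  have : IsProbabilityMeasure ((poissonSample ρ).map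
      fun s => ∑ k, (Pi.single (a (s.2 k)) (h (s.2 k)) : κ → E)) :=
    Measure.isProbabilityMeasure_map (measurable_sum_sample hm).aemeasurable
  -- A law is the product of given laws exactly when its characteristic functional factors
  -- accordingly. Here the factorization is the splitting of the exponent's integral over the fibers
  -- of `a`.
  refine charFunDual_eq_pi_iff.1 fun L => ?_
  simp only [charFunDual_map_sum_poissonSample _ hm, charFunDual_map_sum_poissonSample _ hh]
  rw [← Complex.exp_sum]
  congr 1
  have hint : Integrable (fun y => Complex.exp (L (Pi.single (a y) (h y)) * Complex.I) - 1) ρ := by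
    have hLm : Measurable fun y => L (Pi.single (a y) (h y)) := L.measurable.comp hm
    refine Integrable.of_bound ((Complex.measurable_exp.comp
      ((Complex.measurable_ofReal.comp hLm).mul_const _)).sub_const 1).aestronglyMeasurable 2 (ae_of_all _ fun y => ?_)
    calc _ ≤ ‖Complex.exp (L (Pi.single (a y) (h y)) * Complex.I)‖ + ‖(1 : ℂ)‖ := norm_sub_le _ _
      _ = 2 := by rw [Complex.norm_exp_ofReal_mul_I]; norm_num
  have hcover : (⋃ i, a ⁻¹' {i}) = Set.univ := by
    ext y; simp
  rw [← setIntegral_univ, ← hcover, integral_iUnion_fintype]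
  · refine sum_congr rfl fun i _ => ?_
    refine setIntegral_congr_fun (ha (measurableSet_singleton _)) fun y hy => ?_
    have hy : a y = i := hy
    simp [hy]
  · exact fun i => ha (measurableSet_singleton _)
  · intro i j hij
    exact Disjoint.preimage _ (by simpa using hij)
  · exact fun i => hint.integrableOn

end PoissonSample

/-! ### The two random measures built from a Poisson sample -/

lemma pi_const_smul {ι Y : Type*} [Fintype ι] [MeasurableSpace Y] (c : ℝ≥0) (μ : Measure Y)
    [IsFiniteMeasure μ] :
    Measure.pi (fun _ : ι => c • μ) = (c : ℝ≥0∞) ^ Fintype.card ι • Measure.pi fun _ : ι => μ := by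
  refine Measure.pi_eq fun s _ => ?_
  simp only [Measure.smul_apply, Measure.pi_pi, Measure.nnreal_smul_coe_apply, prod_mul_distrib,
    prod_const, card_univ, smul_eq_mul]

lemma iIndepFun_of_map_eq_pi {S ι : Type*} [Fintype ι] [MeasurableSpace S] {P : Measure S}
    [IsProbabilityMeasure P] {β : ι → Type*} [∀ i, MeasurableSpace (β i)] {f : ∀ i, S → β i}
    (hf : ∀ i, Measurable (f i)) {ν : ∀ i, Measure (β i)} [∀ i, IsProbabilityMeasure (ν i)]
    (h : P.map (fun s i => f i s) = Measure.pi ν) :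
    iIndepFun f P ∧ ∀ i, P.map (f i) = ν i := by
  have hm : ∀ i, P.map (f i) = ν i := fun i => by
    rw [← (measurePreserving_eval ν i).map_eq, ← h,
      Measure.map_map (measurable_pi_apply i) (measurable_pi_iff.2 hf)]
    rfl
  refine ⟨(iIndepFun_iff_map_fun_eq_pi_map fun i => (hf i).aemeasurable).2 ?_, hm⟩
  simp only [hm, h]

section Construction

variable {Ω : Type*} [MeasurableSpace Ω]

/-- The random measure with an atom of weight `1` at each sample point. -/
noncomputable def tableMeasure (s : Sample (Ω × ℕ)) : Measure Ω :=
  ∑ k, Measure.dirac (s.2 k).1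

/-- The random measure with an atom at each sample point, of weight the mark of the point. -/
noncomputable def customerMeasure (s : Sample (Ω × ℕ)) : Measure Ω :=
  ∑ k, ((s.2 k).2 : ℝ≥0∞) • Measure.dirac (s.2 k).1

open Classical in
/-- The total mark and the number of the sample points in `A`. -/
noncomputable def counts (A : Set Ω) (s : Sample (Ω × ℕ)) : ℕ × ℕ :=
  ∑ k, if (s.2 k).1 ∈ A then ((s.2 k).2, 1) else 0

lemma customerMeasure_apply {A : Set Ω} (hA : MeasurableSet A) (s : Sample (Ω × ℕ)) :
    customerMeasure s A = (counts A s).1 := by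
  classical
  simp only [customerMeasure, counts, Prod.fst_sum, Measure.finsetSum_apply, Measure.smul_apply,
    Measure.dirac_apply' _ hA, Set.indicator_apply, Nat.cast_sum]
  refine sum_congr rfl fun k _ => ?_
  split_ifs <;> simp

lemma tableMeasure_apply {A : Set Ω} (hA : MeasurableSet A) (s : Sample (Ω × ℕ)) :
    tableMeasure s A = (counts A s).2 := by
  classical
  simp only [tableMeasure, counts, Prod.snd_sum, Measure.finsetSum_apply,
    Measure.dirac_apply' _ hA, Set.indicator_apply, Nat.cast_sum]
  refine sum_congr rfl fun k _ => ?_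
  split_ifs <;> simp

lemma measurable_counts {A : Set Ω} (hA : MeasurableSet A) : Measurable (counts A) := by
  classical
  refine measurable_of_sample fun n => ?_
  change Measurable fun y : Fin n → Ω × ℕ => ∑ k, if (y k).1 ∈ A then ((y k).2, 1) else 0
  refine Finset.measurable_sum _ fun k _ => Measurable.ite ?_ (by fun_prop) measurable_const
  exact (measurable_fst.comp (measurable_pi_apply k)) hA

lemma measurable_customerMeasure : Measurable (customerMeasure (Ω := Ω)) := by
  refine Measure.measurable_of_measurable_coe _ fun A hA => ?_
  simp only [customerMeasure_apply hA]
  exact (measurable_of_countable (fun n : ℕ × ℕ => (n.1 : ℝ≥0∞))).comp (measurable_counts hA)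

lemma measurable_tableMeasure : Measurable (tableMeasure (Ω := Ω)) := by
  refine Measure.measurable_of_measurable_coe _ fun A hA => ?_
  simp only [tableMeasure_apply hA]
  exact (measurable_of_countable (fun n : ℕ × ℕ => (n.2 : ℝ≥0∞))).comp (measurable_counts hA)

/-- The law of a Poisson sample with intensity `-log (1 - p) G₀` and independent `Log(p)` marks. -/
noncomputable def restaurantSample (G₀ : Measure Ω) (p : Set.Ioo (0 : ℝ) 1) :
    Measure (Sample (Ω × ℕ)) :=
  poissonSample ((logRate p • G₀).prod (logMeasure p))

variable (G₀ : Measure Ω) [IsFiniteMeasure G₀] (p : Set.Ioo (0 : ℝ) 1)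

instance : IsProbabilityMeasure (restaurantSample G₀ p) := by
  unfold restaurantSample; infer_instance

/-- The mark `(u, 1)` of a sample point. -/
def pairMark (y : Ω × ℕ) : ℝ × ℝ := (y.2, 1)

lemma measurable_pairMark : Measurable (pairMark (Ω := Ω)) :=
  ((measurable_from_top (f := fun n : ℕ => ((n : ℝ), (1 : ℝ)))).comp measurable_snd)

-- Passes between integer counts and the real marks that characteristic functionals on a normed
-- space require.
omit [MeasurableSpace Ω] in
lemma sum_pairMark_eq_counts (A : Set Ω) [DecidablePred (· ∈ A)] (s : Sample (Ω × ℕ)) :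
    (∑ k, if (s.2 k).1 ∈ A then pairMark (s.2 k) else 0) =
      (((counts A s).1 : ℝ), ((counts A s).2 : ℝ)) := by
  classical
  have hc : ∀ x : ℕ × ℕ, ((x.1 : ℝ), (x.2 : ℝ)) =
      (AddMonoidHom.prodMap (Nat.castAddMonoidHom ℝ) (Nat.castAddMonoidHom ℝ)) x := fun _ => rfl
  rw [hc, counts, map_sum]
  refine sum_congr rfl fun k _ => ?_
  by_cases h : (s.2 k).1 ∈ A
  · simp [h, pairMark]
  · simp only [h, if_false, map_zero]

/-- The joint law of mark sum and number of points, for a total intensity `G₀ A`. -/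
lemma poissonSample_restrict_singleton (A : Set Ω) (m l : ℕ) :
    ((poissonSample (((logRate p • G₀).prod (logMeasure p)).restrict (Prod.fst ⁻¹' A))).map
      fun s => ∑ k, pairMark (s.2 k)) {((m : ℝ), (l : ℝ))} =
    poissonMeasure (logRate p * (G₀ A).toNNReal) {l} * sumLogMeasure p l {m} := by
  set c : ℝ≥0 := logRate p * (G₀ A).toNNReal with hc
  have hcA : (logRate p • G₀) A = c := by
    rw [hc, ENNReal.coe_mul, ENNReal.coe_toNNReal (by finiteness)]
    rfl
  set ρ := ((logRate p • G₀).prod (logMeasure p)).restrict (Prod.fst ⁻¹' A) with hρ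
  have hρ' : ρ = ((logRate p • G₀).restrict A).prod (logMeasure p) := by
    rw [Measure.restrict_prod_eq_prod_univ, hρ, Set.prod_univ]
  have hsnd : ρ.map Prod.snd = c • logMeasure p := by
    rw [hρ', Measure.map_snd_prod, Measure.restrict_apply_univ, hcA]; rfl
  have huniv : ρ.real Set.univ = c := by
    rw [measureReal_def, hρ', ← Set.univ_prod_univ, Measure.prod_prod, Measure.restrict_apply_univ, hcA]
    simp
  have hms := measurable_sum_sample (Y := Ω × ℕ) measurable_pairMark
  -- The second coordinate of the mark sum is the length of the list, so only lists of length l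
  -- contribute.
  rw [Measure.map_apply hms (measurableSet_singleton _),
    poissonSample_apply _ _ (hms (measurableSet_singleton _)), tsum_eq_single l]
  · have hset : Sample.of l ⁻¹' ((fun s : Sample (Ω × ℕ) => ∑ k, pairMark (s.2 k)) ⁻¹'
        {((m : ℝ), (l : ℝ))}) = (fun y : Fin l → Ω × ℕ => fun k => (y k).2) ⁻¹'
          ((fun u : Fin l → ℕ => ∑ k, u k) ⁻¹' {m}) := by
      ext y
      simp only [Set.mem_preimage, Set.mem_singleton_iff, pairMark, Prod.ext_iff, Prod.fst_sum,
        Prod.snd_sum]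
      simp only [sum_const, card_univ, Fintype.card_fin, nsmul_eq_mul, mul_one, and_true]
      exact_mod_cast Iff.rfl
    have hfin : ∀ _ : Fin l, SigmaFinite (ρ.map Prod.snd) := fun _ => by rw [hsnd]; infer_instance
    have hpi := Measure.pi_map_pi (μ := fun _ : Fin l => ρ) (f := fun _ => Prod.snd)
      (hμ := hfin) (fun _ => measurable_snd.aemeasurable)
    -- The event depends only on the marks, whose intensity is c times Log(p). The l-fold product
    -- contributes c^l, which completes exp(-c)/l! to the Poisson mass.
    rw [hset, ← Measure.map_apply (by fun_prop) (by measurability), hpi, hsnd, pi_const_smul,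
      Measure.smul_apply, ← Measure.map_apply (by fun_prop) (measurableSet_singleton _),
      ← sumLogMeasure, huniv, poissonMeasure_singleton, smul_eq_mul, Fintype.card_fin,
      ← mul_assoc]
    congr 1
    rw [mul_div_right_comm, ENNReal.ofReal_mul (by positivity),
      ENNReal.ofReal_pow c.coe_nonneg, ENNReal.ofReal_coe_nnreal]
  · intro n hn
    have : Sample.of n ⁻¹' ((fun s : Sample (Ω × ℕ) => ∑ k, pairMark (s.2 k)) ⁻¹'
        {((m : ℝ), (l : ℝ))}) = ∅ := by
      ext y
      simp only [Set.mem_preimage, Set.mem_singleton_iff, pairMark, Prod.ext_iff, Prod.fst_sum,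
        Prod.snd_sum]
      simp [hn]
    rw [this, measure_empty, mul_zero]

variable {κ : Type*} [Fintype κ] [MeasurableSpace κ] [MeasurableSingletonClass κ]

lemma counts_indep {a : Ω → κ} (ha : Measurable a) :
    iIndepFun (fun i => counts (a ⁻¹' {i})) (restaurantSample G₀ p) ∧
    ∀ i m l, restaurantSample G₀ p {s | counts (a ⁻¹' {i}) s = (m, l)} =
      poissonMeasure (logRate p * (G₀ (a ⁻¹' {i})).toNNReal) {l} * sumLogMeasure p l {m} := by
  classical
  have h := map_regions_poissonSample ((logRate p • G₀).prod (logMeasure p))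
    (a := fun y => a y.1) (ha.comp measurable_fst) measurable_pairMark
  have hA : ∀ i, MeasurableSet (a ⁻¹' {i}) := fun i => ha (measurableSet_singleton i)
  have hcast : ∀ (i : κ) (s : Sample (Ω × ℕ)),
      (∑ k, if a (s.2 k).1 = i then pairMark (s.2 k) else 0) =
        (((counts (a ⁻¹' {i}) s).1 : ℝ), ((counts (a ⁻¹' {i}) s).2 : ℝ)) := fun i s =>
    sum_pairMark_eq_counts (a ⁻¹' {i}) s
  simp only [hcast] at h
  have hcm : Measurable fun x : ℕ × ℕ => ((x.1 : ℝ), (x.2 : ℝ)) := measurable_of_countable _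
  have hprob : ∀ i, IsProbabilityMeasure ((poissonSample (((logRate p • G₀).prod
      (logMeasure p)).restrict ((fun y : Ω × ℕ => a y.1) ⁻¹' {i}))).map
        fun s => ∑ k, pairMark (s.2 k)) := fun i =>
    Measure.isProbabilityMeasure_map (measurable_sum_sample measurable_pairMark).aemeasurable
  obtain ⟨hind, hlaw⟩ := iIndepFun_of_map_eq_pi
    (fun i => hcm.comp (measurable_counts (hA i))) (P := restaurantSample G₀ p) h
  refine ⟨?_, fun i m l => ?_⟩
  -- Taking floors recovers the integer counts from their real images, and independence is
  -- preserved.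
  · have := hind.comp (fun _ (x : ℝ × ℝ) => (⌊x.1⌋₊, ⌊x.2⌋₊)) (fun _ =>
      (Nat.measurable_floor.comp measurable_fst).prodMk (Nat.measurable_floor.comp measurable_snd))
    convert this using 2 with i
    funext s
    simp
  · rw [← poissonSample_restrict_singleton G₀ p _ m l]
    refine Eq.trans ?_ (congrArg (fun μ => μ {((m : ℝ), (l : ℝ))}) (hlaw i))
    rw [Measure.map_apply (hcm.comp (measurable_counts (hA i))) (measurableSet_singleton _)]
    congr 1
    ext s
    simp [Prod.ext_iff]

/-- The explicit joint law on a partition. Both conditional descriptions are read off from it, the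
second after applying the one-point identity in each cell. -/
lemma customerMeasure_tableMeasure_singleton {a : Ω → κ} (ha : Measurable a) (m l : κ → ℕ) :
    restaurantSample G₀ p {s | ∀ i, customerMeasure s (a ⁻¹' {i}) = m i ∧
      tableMeasure s (a ⁻¹' {i}) = l i} =
    ∏ i, poissonMeasure (logRate p * (G₀ (a ⁻¹' {i})).toNNReal) {l i} *
      sumLogMeasure p (l i) {m i} := by
  obtain ⟨h1, h2⟩ := counts_indep G₀ p ha
  have h := h1.measure_inter_preimage_eq_mul univ (sets := fun i => {(m i, l i)})
    (fun i _ => measurableSet_singleton _)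
  have hset : {s | ∀ i, customerMeasure s (a ⁻¹' {i}) = m i ∧ tableMeasure s (a ⁻¹' {i}) = l i} =
      ⋂ i ∈ univ, counts (a ⁻¹' {i}) ⁻¹' {(m i, l i)} := by
    ext s
    simp [customerMeasure_apply (ha (measurableSet_singleton _)),
      tableMeasure_apply (ha (measurableSet_singleton _)), Prod.ext_iff]
  rw [hset, h]
  exact prod_congr rfl fun i _ => h2 i (m i) (l i)

end Construction

/-! ### Count measures -/

/-- If independent counts outside the range of an injection `e` vanish, then the counts in the range
of `e` determine all of them. -/
lemma pi_eq_map_extend {D C : Type*} [Fintype D] [Fintype C] [DecidableEq C] {e : D → C}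
    (he : Function.Injective e) (ν : C → Measure ℕ) [∀ c, IsProbabilityMeasure (ν c)]
    (h0 : ∀ c, c ∉ Set.range e → ν c = Measure.dirac 0) :
    Measure.pi ν = (Measure.pi fun d => ν (e d)).map
      fun y c => ∑ d, if e d = c then y d else 0 := by
  have hval : ∀ (y : D → ℕ) d, (∑ d', if e d' = e d then y d' else 0) = y d := fun y d => by
    classical
    simp [he.eq_iff]
  refine Measure.ext_of_singleton fun v => ?_
  rw [Measure.map_apply (measurable_of_countable _) (measurableSet_singleton _),
    Measure.pi_singleton]
  by_cases hv : ∀ c, c ∉ Set.range e → v c = 0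
  · have hset : (fun (y : D → ℕ) c => ∑ d, if e d = c then y d else 0) ⁻¹' {v} = {v ∘ e} := by
      ext y
      simp only [Set.mem_preimage, Set.mem_singleton_iff]
      constructor
      · rintro rfl
        funext d
        exact (hval y d).symm
      · rintro rfl
        funext c
        by_cases hc : c ∈ Set.range e
        · obtain ⟨d, rfl⟩ := hc
          exact hval (v ∘ e) d
        · rw [hv c hc]
          refine sum_eq_zero fun d _ => if_neg fun h => hc ⟨d, h⟩
    rw [hset, Measure.pi_singleton]
    simp only [Function.comp_apply]
    rw [← Finset.prod_image (s := univ) (g := e) (f := fun c => ν c {v c}) (fun x _ y _ h => he h)]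
    refine (prod_subset (subset_univ _) fun c _ hc => ?_).symm
    have hc' : c ∉ Set.range e := by simpa using hc
    rw [h0 c hc', hv c hc']
    simp
  · push Not at hv
    obtain ⟨c, hc, hvc⟩ := hv
    have hset : (fun (y : D → ℕ) c => ∑ d, if e d = c then y d else 0) ⁻¹' {v} = ∅ := by
      ext y
      simp only [Set.mem_preimage, Set.mem_singleton_iff, Set.mem_empty_iff_false, iff_false]
      rintro rfl
      exact hvc (sum_eq_zero fun d _ => if_neg fun h => hc ⟨d, h⟩)
    rw [hset, measure_empty]
    refine prod_eq_zero (mem_univ c) ?_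
    rw [h0 c hc, Measure.dirac_apply' _ (measurableSet_singleton _)]
    simp [hvc.symm]

lemma measurableSet_natCast : MeasurableSet {r : ℝ≥0∞ | ∃ k : ℕ, r = k} := by
  convert (Set.countable_range fun k : ℕ => (k : ℝ≥0∞)).measurableSet using 1
  ext r
  simp [eq_comm]

section Count

variable {Ω : Type*} [MeasurableSpace Ω] [StandardBorelSpace Ω]

/-- The first `n` letters of the code of a point in the Cantor space. -/
noncomputable def prefixCode (n : ℕ) (ω : Ω) : Fin n → Bool :=
  fun i => MeasurableSpace.mapNatBool Ω ω i

lemma measurable_prefixCode (n : ℕ) : Measurable (prefixCode (Ω := Ω) n) :=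
  measurable_pi_iff.2 fun i => (measurable_pi_apply (i : ℕ)).comp
    (MeasurableSpace.measurable_mapNatBool Ω)

lemma prefixCode_eq_of_le {m n : ℕ} (h : m ≤ n) {ω ω' : Ω}
    (hn : prefixCode n ω = prefixCode n ω') : prefixCode m ω = prefixCode m ω' :=
  funext fun i => congrFun hn (Fin.castLE h i)

lemma exists_prefixCode_ne {ω ω' : Ω} (h : ω ≠ ω') :
    ∃ n, prefixCode n ω ≠ prefixCode n ω' := by
  by_contra! hn
  refine h (MeasurableSpace.injective_mapNatBool Ω (funext fun i => ?_))
  exact congrFun (hn (i + 1)) (Fin.last i)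

/-- The points that share the first `n` letters of their code with `ω`. -/
noncomputable def prefixCell (n : ℕ) (ω : Ω) : Set Ω := prefixCode n ⁻¹' {prefixCode n ω}

lemma measurableSet_prefixCell (n : ℕ) (ω : Ω) : MeasurableSet (prefixCell n ω) :=
  measurable_prefixCode n (measurableSet_singleton _)

lemma antitone_prefixCell (ω : Ω) : Antitone fun n => prefixCell n ω :=
  fun _ _ h _ hx => prefixCode_eq_of_le h hx

lemma iInter_prefixCell (ω : Ω) : ⋂ n, prefixCell n ω = {ω} := by
  ext x
  simp only [Set.mem_iInter, Set.mem_singleton_iff]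
  refine ⟨fun h => ?_, fun h n => by rw [h]; rfl⟩
  by_contra hne
  obtain ⟨n, hn⟩ := exists_prefixCode_ne hne
  exact hn (h n)

/-- A measure is integer-valued on all cells of the partitions by prefixes. -/
def IsCount (x : Measure Ω) : Prop := ∀ n (v : Fin n → Bool), ∃ k : ℕ, x (prefixCode n ⁻¹' {v}) = k

lemma measurableSet_isCount : MeasurableSet {x : Measure Ω | IsCount x} := by
  simp only [IsCount, Set.ofPred_forall]
  exact MeasurableSet.iInter fun n => MeasurableSet.iInter fun v => Measure.measurable_coe
    (measurable_prefixCode (Ω := Ω) n (measurableSet_singleton v)) measurableSet_natCast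

namespace IsCount

variable {x : Measure Ω} (hx : IsCount x)

include hx

lemma isFiniteMeasure : IsFiniteMeasure x := by
  obtain ⟨k, hk⟩ := hx 0 default
  refine ⟨?_⟩
  have : prefixCode (Ω := Ω) 0 ⁻¹' {default} = Set.univ := by
    ext ω; simp [Subsingleton.elim (prefixCode 0 ω) default]
  rw [← this, hk]
  exact ENNReal.natCast_lt_top k

/-- The mass of small cells around a point is the mass of the point. -/
lemma exists_prefixCell_eq (ω : Ω) : ∃ n, x (prefixCell n ω) = x {ω} := by
  have := hx.isFiniteMeasure
  choose k hk using fun n => hx n (prefixCode n ω)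
  have hanti : Antitone k := fun m n hmn => by
    have h : x (prefixCell n ω) ≤ x (prefixCell m ω) := measure_mono (antitone_prefixCell ω hmn)
    rw [prefixCell, hk, prefixCell, hk] at h
    exact_mod_cast h
  -- A decreasing sequence of natural numbers stabilizes, and continuity from above identifies its
  -- final value as the mass of the point.
  obtain ⟨N, hN⟩ := WellFoundedLT.antitone_chain_condition hanti
  have hlim := tendsto_measure_iInter_atTop (μ := x)
    (fun n => (measurableSet_prefixCell n ω).nullMeasurableSet) (antitone_prefixCell ω)
    ⟨0, measure_ne_top _ _⟩
  rw [iInter_prefixCell] at hlim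
  refine ⟨N, tendsto_nhds_unique (tendsto_const_nhds.congr' ?_) hlim⟩
  filter_upwards [eventually_ge_atTop N] with n hn
  change x (prefixCode N ⁻¹' {prefixCode N ω}) = x (prefixCode n ⁻¹' {prefixCode n ω})
  rw [hk, hk, hN n hn]

lemma exists_singleton_eq (ω : Ω) : ∃ k : ℕ, x {ω} = k := by
  obtain ⟨n, hn⟩ := hx.exists_prefixCell_eq ω
  obtain ⟨k, hk⟩ := hx n (prefixCode n ω)
  exact ⟨k, by rw [← hn, prefixCell, hk]⟩

/-- Each atom has mass at least 1 and the total mass is finite. -/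
lemma finite_atoms : {ω | x {ω} ≠ 0}.Finite := by
  have := hx.isFiniteMeasure
  refine (Measure.finite_const_le_meas_of_disjoint_iUnion x (ε := 1) one_pos
    (As := fun ω : Ω => {ω}) (fun ω => measurableSet_singleton ω) ?_ (measure_ne_top _ _)).subset ?_
  · intro a b hab
    simpa using hab
  · intro ω hω
    obtain ⟨k, hk⟩ := hx.exists_singleton_eq ω
    simp only [Set.mem_ofPred_eq] at hω ⊢
    rw [hk] at hω ⊢
    have : k ≠ 0 := by exact_mod_cast hω
    exact_mod_cast Nat.one_le_iff_ne_zero.2 this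

lemma finite_atoms_subtype : Finite {ω : Ω // x {ω} ≠ 0} := hx.finite_atoms.to_subtype

/-- A point without mass lies in some prefix cell of mass 0, and there are only countably many
prefix cells. Hence x is purely atomic. -/
lemma measure_compl_atoms : x {ω | x {ω} ≠ 0}ᶜ = 0 := by
  refine measure_mono_null (t := ⋃ n, ⋃ v : Fin n → Bool,
    ⋃ _ : x (prefixCode n ⁻¹' {v}) = 0, prefixCode n ⁻¹' {v}) ?_ ?_
  · intro ω hω
    obtain ⟨n, hn⟩ := hx.exists_prefixCell_eq ω
    simp only [Set.mem_compl_iff, Set.mem_ofPred_eq, not_not] at hω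
    simp only [Set.mem_iUnion]
    exact ⟨n, prefixCode n ω, by rw [← hω, ← hn]; rfl, rfl⟩
  · exact measure_iUnion_null fun n => measure_iUnion_null fun v => measure_iUnion_null fun h => h

omit [StandardBorelSpace Ω] hx in
lemma natFloor_eq {A : Set Ω} {k : ℕ} (h : x A = k) : ⌊(x A).toReal⌋₊ = k := by
  simp [h]

lemma apply_eq_sum [Fintype {ω // x {ω} ≠ 0}] {A : Set Ω} [DecidablePred (· ∈ A)]
    (hA : MeasurableSet A) :
    x A = ((∑ ω : {ω // x {ω} ≠ 0}, if ω.1 ∈ A then ⌊(x {ω.1}).toReal⌋₊ else 0 : ℕ) : ℝ≥0∞) := by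
  have h1 : x A = x (A ∩ {ω | x {ω} ≠ 0}) := by
    refine le_antisymm ?_ (measure_mono Set.inter_subset_left)
    calc x A ≤ x (A ∩ {ω | x {ω} ≠ 0}) + x (A \ {ω | x {ω} ≠ 0}) := measure_le_inter_add_sdiff _ _ _
      _ = x (A ∩ {ω | x {ω} ≠ 0}) := by
        rw [measure_mono_null (s := A \ {ω | x {ω} ≠ 0}) (fun ω h => h.2) hx.measure_compl_atoms,
          add_zero]
  have h2 : A ∩ {ω | x {ω} ≠ 0} =
      ⋃ ω ∈ (univ : Finset {ω // x {ω} ≠ 0}), A ∩ {ω.1} := by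
    ext ω
    simp only [Set.mem_inter_iff, Set.mem_ofPred_eq, Set.mem_iUnion, Set.mem_singleton_iff,
      mem_univ, exists_prop, true_and, Subtype.exists]
    constructor
    · rintro ⟨h, h'⟩; exact ⟨ω, h', h, rfl⟩
    · rintro ⟨ω', h', h, rfl⟩; exact ⟨h, h'⟩
  rw [h1, h2, measure_biUnion_finset, Nat.cast_sum]
  · refine sum_congr rfl fun ω _ => ?_
    split_ifs with h
    · obtain ⟨k, hk⟩ := hx.exists_singleton_eq ω.1
      rw [Set.inter_eq_right.2 (Set.singleton_subset_iff.2 h), natFloor_eq hk, hk]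
    · rw [Set.inter_singleton_eq_empty.2 h, measure_empty, Nat.cast_zero]
  · intro a _ b _ hab
    refine Set.disjoint_left.2 ?_
    rintro ω ⟨-, h⟩ ⟨-, h'⟩
    exact hab (Subtype.ext (Eq.trans (Eq.symm h) h'))
  · exact fun ω _ => hA.inter (measurableSet_singleton _)

end IsCount

end Count

/-! ### Atomwise laws as limits of laws on cells -/

section Cells

variable {Ω : Type*} [MeasurableSpace Ω]

section CellKernel

variable {C : Type*} [Fintype C] [MeasurableSpace C] [MeasurableSingletonClass C]

/-- The integer parts of the masses of the cells of a finite partition. -/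
noncomputable def cellCounts (c : Ω → C) (x : Measure Ω) : C → ℕ :=
  fun j => ⌊(x (c ⁻¹' {j})).toReal⌋₊

omit [Fintype C] in
lemma measurable_cellCounts {c : Ω → C} (hc : Measurable c) : Measurable (cellCounts c) :=
  measurable_pi_iff.2 fun j => Nat.measurable_floor.comp
    (Measure.measurable_coe (hc (measurableSet_singleton j))).ennreal_toReal

/-- Given counts in the cells of a finite partition, independent counts with laws `Q`. -/
noncomputable def cellKernel (Q : Set Ω → ℕ → Measure ℕ) (c : Ω → C) : Kernel (C → ℕ) (C → ℕ) :=
  ⟨fun m => Measure.pi fun j => Q (c ⁻¹' {j}) (m j), measurable_of_countable _⟩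

omit [MeasurableSpace C] [MeasurableSingletonClass C] [MeasurableSpace Ω] in
lemma cellKernel_apply (Q : Set Ω → ℕ → Measure ℕ) (c : Ω → C) (m : C → ℕ) :
    cellKernel Q c m = Measure.pi fun j => Q (c ⁻¹' {j}) (m j) := rfl

instance (Q : Set Ω → ℕ → Measure ℕ) [∀ A k, IsProbabilityMeasure (Q A k)] (c : Ω → C) :
    IsMarkovKernel (cellKernel Q c) :=
  ⟨fun m => by rw [cellKernel_apply]; infer_instance⟩

end CellKernel

variable {κ : Type*} [Fintype κ] [MeasurableSpace κ] [MeasurableSingletonClass κ]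

omit [Fintype κ] [MeasurableSpace κ] [MeasurableSingletonClass κ] in
/-- Only finitely many counts at finitely many points have given sums over the fibers of `a`. -/
lemma finite_fiberSums {D : Type*} [Fintype D] [DecidableEq κ] (a : D → κ) (b : κ → ℕ) :
    {y : D → ℕ | ∀ i, (∑ ω, if a ω = i then y ω else 0) = b i}.Finite := by
  classical
  refine (Set.finite_Iic (fun ω => b (a ω))).subset fun y hy ω => ?_
  change y ω ≤ b (a ω)
  rw [← hy (a ω)]
  have := single_le_sum (f := fun ω' => if a ω' = a ω then y ω' else 0)
    (fun _ _ => Nat.zero_le _) (mem_univ ω)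
  simpa using this

variable [StandardBorelSpace Ω]

/-- The refinement of a partition by the partition into cells of points with the same prefix. -/
noncomputable def refineCells (a : Ω → κ) (n : ℕ) (ω : Ω) : κ × (Fin n → Bool) :=
  (a ω, prefixCode n ω)

omit [Fintype κ] [MeasurableSingletonClass κ] in
lemma measurable_refineCells {a : Ω → κ} (ha : Measurable a) (n : ℕ) :
    Measurable (refineCells a n) :=
  ha.prodMk (measurable_prefixCode n)

/-- The conditional probability of counts `b` in the cells of `a`, computed as if all points of a
cell of the `n`-th refinement were at the same place. -/
noncomputable def cellApprox (Q : Set Ω → ℕ → Measure ℕ) (a : Ω → κ) (n : ℕ) (x : Measure Ω)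
    (b : κ → ℕ) : ℝ≥0∞ :=
  cellKernel Q (refineCells a n) (cellCounts (refineCells a n) x) {v | ∀ i, ∑ w, v (i, w) = b i}

lemma measurable_cellApprox (Q : Set Ω → ℕ → Measure ℕ) {a : Ω → κ} (ha : Measurable a) (n : ℕ)
    (b : κ → ℕ) : Measurable fun x => cellApprox Q a n x b :=
  (measurable_of_countable fun m : κ × (Fin n → Bool) → ℕ =>
    cellKernel Q (refineCells a n) m {v | ∀ i, ∑ w, v (i, w) = b i}).comp
      (measurable_cellCounts (measurable_refineCells ha n))

omit [Fintype κ] [StandardBorelSpace Ω] in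
lemma sum_smul_dirac_apply {D : Type*} [Fintype D] (f : D → Ω) (y : D → ℕ) [DecidableEq κ]
    {a : Ω → κ} (ha : Measurable a) (i : κ) :
    Measure.sum (fun ω => (y ω : ℝ≥0∞) • Measure.dirac (f ω)) (a ⁻¹' {i}) =
      ((∑ ω, if a (f ω) = i then y ω else 0 : ℕ) : ℝ≥0∞) := by
  have hA := ha (measurableSet_singleton i)
  rw [Measure.sum_apply _ hA, tsum_fintype, Nat.cast_sum]
  refine sum_congr rfl fun ω _ => ?_
  rw [Measure.smul_apply, Measure.dirac_apply' _ hA]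
  by_cases h : a (f ω) = i <;> simp [h]

omit [StandardBorelSpace Ω] in
lemma measurable_sum_smul_dirac {D : Type*} [Finite D] (f : D → Ω) :
    Measurable fun y : D → ℕ => Measure.sum fun ω => (y ω : ℝ≥0∞) • Measure.dirac (f ω) := by
  have := Fintype.ofFinite D
  exact measurable_of_countable _

omit [StandardBorelSpace Ω] in
lemma atomwiseLaw_eq_map (q : Ω → ℕ → Measure ℕ) [∀ ω n, IsProbabilityMeasure (q ω n)]
    {x : Measure Ω} [Fintype {ω // x {ω} ≠ 0}] :
    atomwiseLaw q x = (Measure.pi fun ω : {ω : Ω // x {ω} ≠ 0} => q ω ⌊(x {ω.1}).toReal⌋₊).map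
      fun y => Measure.sum fun ω => (y ω : ℝ≥0∞) • Measure.dirac ω.1 := by
  rw [atomwiseLaw, Measure.infinitePi_eq_pi]

lemma IsCount.isProbabilityMeasure_atomwiseLaw (q : Ω → ℕ → Measure ℕ)
    [∀ ω n, IsProbabilityMeasure (q ω n)] {x : Measure Ω} (hx : IsCount x) :
    IsProbabilityMeasure (atomwiseLaw q x) := by
  have := hx.finite_atoms_subtype
  exact Measure.isProbabilityMeasure_map
    (measurable_sum_smul_dirac (D := {ω : Ω // x {ω} ≠ 0}) _).aemeasurable

omit [StandardBorelSpace Ω] in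
lemma measurableSet_cell_eq {a : Ω → κ} (ha : Measurable a) (b : κ → ℕ) :
    MeasurableSet {y : Measure Ω | ∀ i, y (a ⁻¹' {i}) = b i} := by
  simp only [Set.ofPred_forall]
  exact MeasurableSet.iInter fun i => Measure.measurable_coe (ha (measurableSet_singleton i))
    (measurableSet_singleton _)

omit [StandardBorelSpace Ω] in
lemma atomwiseLaw_apply (q : Ω → ℕ → Measure ℕ) [∀ ω n, IsProbabilityMeasure (q ω n)]
    [DecidableEq κ] {x : Measure Ω} [Fintype {ω // x {ω} ≠ 0}] {a : Ω → κ} (ha : Measurable a)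
    (b : κ → ℕ) :
    atomwiseLaw q x {y | ∀ i, y (a ⁻¹' {i}) = b i} =
      (Measure.pi fun ω : {ω : Ω // x {ω} ≠ 0} => q ω ⌊(x {ω.1}).toReal⌋₊)
        {y | ∀ i, (∑ ω, if a ω.1 = i then y ω else 0) = b i} := by
  rw [atomwiseLaw_eq_map, Measure.map_apply (measurable_sum_smul_dirac _)
    (measurableSet_cell_eq ha b)]
  congr 1
  ext y
  simp only [Set.mem_preimage, Set.mem_ofPred_eq, sum_smul_dirac_apply _ y ha, Nat.cast_inj]

/-- Under the atomwise law, the masses are integers. -/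
lemma IsCount.ae_atomwiseLaw (q : Ω → ℕ → Measure ℕ) [∀ ω n, IsProbabilityMeasure (q ω n)]
    {x : Measure Ω} (hx : IsCount x) {a : Ω → κ} (ha : Measurable a) :
    ∀ᵐ y ∂(atomwiseLaw q x), ∀ i, ∃ k : ℕ, y (a ⁻¹' {i}) = (k : ℝ≥0∞) := by
  classical
  have := hx.finite_atoms_subtype
  have : Fintype {ω : Ω // x {ω} ≠ 0} := Fintype.ofFinite _
  rw [atomwiseLaw_eq_map, ae_map_iff (measurable_sum_smul_dirac _).aemeasurable]
  · exact ae_of_all _ fun y i => ⟨_, sum_smul_dirac_apply _ y ha i⟩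
  · simp only [Set.ofPred_forall]
    exact MeasurableSet.iInter fun i =>
      Measure.measurable_coe (ha (measurableSet_singleton i)) measurableSet_natCast

/-- The approximations on fine cells converge to the atomwise law. -/
lemma IsCount.tendsto_cellApprox {x : Measure Ω} (hx : IsCount x)
    (Q : Set Ω → ℕ → Measure ℕ) [∀ A k, IsProbabilityMeasure (Q A k)]
    (hQ0 : ∀ A, Q A 0 = Measure.dirac 0)
    (hQc : ∀ (A : ℕ → Set Ω) (ω : Ω), Antitone A → (∀ n, MeasurableSet (A n)) →
      ⋂ n, A n = {ω} → ∀ k l, Tendsto (fun n => Q (A n) k {l}) atTop (𝓝 (Q {ω} k {l})))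
    {a : Ω → κ} (ha : Measurable a) (b : κ → ℕ) :
    Tendsto (fun n => cellApprox Q a n x b) atTop
      (𝓝 (atomwiseLaw (fun ω k => Q {ω} k) x {y | ∀ i, y (a ⁻¹' {i}) = b i})) := by
  classical
  have := hx.finite_atoms_subtype
  have : Fintype {ω : Ω // x {ω} ≠ 0} := Fintype.ofFinite _
  rw [atomwiseLaw_apply _ ha]
  -- Only finitely many vectors of atom counts have the prescribed sums, so the probability is a
  -- finite sum of finite products and limits may be taken termwise.
  have hfin := finite_fiberSums (fun ω : {ω : Ω // x {ω} ≠ 0} => a ω.1) b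
  have hsum : ∀ μ : {ω : Ω // x {ω} ≠ 0} → Measure ℕ, (∀ d, IsProbabilityMeasure (μ d)) →
      Measure.pi μ {y | ∀ i, (∑ ω : {ω : Ω // x {ω} ≠ 0}, if a ω.1 = i then y ω else 0) = b i} =
        ∑ y ∈ hfin.toFinset, ∏ ω, μ ω {y ω} := by
    intro μ _
    have h := sum_measure_singleton (μ := Measure.pi μ) (s := hfin.toFinset)
    rw [hfin.coe_toFinset] at h
    simp only [← h, Measure.pi_singleton]
  have hlim := hsum (fun ω => Q {ω.1} ⌊(x {ω.1}).toReal⌋₊) fun _ => inferInstance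
  rw [hlim]
  -- There are finitely many atoms, so sufficiently fine partitions separate them.
  have hinj : ∀ᶠ n in atTop, Function.Injective fun ω : {ω : Ω // x {ω} ≠ 0} => refineCells a n ω.1 := by
    have h : ∀ ω ω' : {ω : Ω // x {ω} ≠ 0}, ∀ᶠ n in atTop, refineCells a n ω.1 = refineCells a n ω'.1 → ω = ω' := by
      intro ω ω'
      by_cases hne : ω = ω'
      · exact Eventually.of_forall fun _ _ => hne
      · obtain ⟨N, hN⟩ := exists_prefixCode_ne (fun h => hne (Subtype.ext h) : ω.1 ≠ ω'.1)
        filter_upwards [eventually_ge_atTop N] with n hn heq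
        exact absurd (prefixCode_eq_of_le hn (congrArg Prod.snd heq)) hN
    filter_upwards [eventually_all.2 fun ω => eventually_all.2 (h ω)] with n hn ω ω' using hn ω ω'
  refine Tendsto.congr' (f₁ := fun n => ∑ y ∈ hfin.toFinset, ∏ ω : {ω : Ω // x {ω} ≠ 0},
    Q (refineCells a n ⁻¹' {refineCells a n ω.1}) ⌊(x {ω.1}).toReal⌋₊ {y ω}) ?_ ?_
  -- Once the atoms are separated, a cell with an atom has that atom's mass as its count. Every
  -- other cell has count 0, hence law `dirac 0` by `hQ0`, and drops out.
  · filter_upwards [hinj] with n hn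
    have hcell : ∀ c, cellCounts (refineCells a n) x c =
        ∑ ω : {ω : Ω // x {ω} ≠ 0}, if refineCells a n ω.1 = c then ⌊(x {ω.1}).toReal⌋₊ else 0 := fun c => by
      have := hx.apply_eq_sum (measurable_refineCells ha n (measurableSet_singleton c))
      rw [cellCounts, IsCount.natFloor_eq this]
      simp only [Set.mem_preimage, Set.mem_singleton_iff]
    have hcell1 : ∀ ω : {ω : Ω // x {ω} ≠ 0}, cellCounts (refineCells a n) x (refineCells a n ω.1) =
        ⌊(x {ω.1}).toReal⌋₊ := fun ω => by
      rw [hcell, sum_eq_single ω]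
      · rw [if_pos rfl]
      · exact fun ω' _ hne => if_neg fun h => hne (hn h)
      · simp
    rw [cellApprox, cellKernel_apply, pi_eq_map_extend hn,
      Measure.map_apply (measurable_of_countable _) (Set.to_countable _).measurableSet]
    · simp only [hcell1]
      rw [← hsum _ fun _ => inferInstance]
      congr 1
      ext y
      simp only [Set.mem_ofPred_eq, Set.mem_preimage]
      refine forall_congr' fun i => ?_
      rw [sum_comm]
      have : ∀ ω : {ω : Ω // x {ω} ≠ 0}, (∑ w, if refineCells a n ω.1 = (i, w) then y ω else 0) =
          if a ω.1 = i then y ω else 0 := fun ω => by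
        simp only [refineCells, Prod.mk.injEq]
        by_cases h : a ω.1 = i <;> simp [h]
      simp only [this]
    · intro c hc
      have : cellCounts (refineCells a n) x c = 0 := by
        rw [hcell]
        exact sum_eq_zero fun ω _ => if_neg fun h => hc ⟨ω, h⟩
      rw [this, hQ0]
  · refine tendsto_finsetSum _ fun y _ => ENNReal.tendsto_finsetProd_of_ne_top _ (fun ω _ => ?_)
      fun ω _ => measure_ne_top _ _
    refine hQc (fun n => refineCells a n ⁻¹' {refineCells a n ω.1}) ω.1 ?_ ?_ ?_ _ _
    · intro m n h z hz
      exact Prod.ext (congrArg Prod.fst hz :)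
        (prefixCode_eq_of_le h (congrArg Prod.snd hz))
    · exact fun n => measurable_refineCells ha n (measurableSet_singleton _)
    · ext z
      simp only [Set.mem_iInter, Set.mem_preimage, Set.mem_singleton_iff]
      refine ⟨fun h => ?_, fun h n => by rw [h]⟩
      by_contra hne
      obtain ⟨n, hn⟩ := exists_prefixCode_ne hne
      exact hn (congrArg Prod.snd (h n))

end Cells

/-! ### Laws of random measures are determined by finite partitions -/

section Evaluation

universe u

variable {Ω : Type u} [MeasurableSpace Ω]

/-- The values of a measure on all measurable sets. -/
def evalAll (x : Measure Ω) (A : {A : Set Ω // MeasurableSet A}) : ℝ≥0∞ := x A.1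

lemma measurable_evalAll : Measurable (evalAll (Ω := Ω)) :=
  measurable_pi_iff.2 fun A => Measure.measurable_coe A.2

/-- The σ-algebra on measures is generated by evaluations, so cylinders in the evaluations form a
generating π-system. -/
lemma comap_evalAll :
    MeasurableSpace.comap (evalAll (Ω := Ω)) inferInstance =
      Measure.instMeasurableSpace := by
  refine le_antisymm measurable_evalAll.comap_le fun s hs => ?_
  have h : @Measurable _ _ (MeasurableSpace.comap (evalAll (Ω := Ω)) inferInstance) _
      (id : Measure Ω → Measure Ω) :=
    @Measure.measurable_of_measurable_coe Ω (Measure Ω) _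
      (MeasurableSpace.comap (evalAll (Ω := Ω)) inferInstance) id fun A hA =>
        (measurable_pi_apply (⟨A, hA⟩ : {A : Set Ω // MeasurableSet A})).comp
          (comap_measurable (evalAll (Ω := Ω)))
  exact h hs

/-- The partition generated by finitely many measurable sets. -/
noncomputable def memberCells (I : Finset {A : Set Ω // MeasurableSet A}) (ω : Ω) (A : I) : Bool :=
  open Classical in decide (ω ∈ A.1.1)

lemma measurable_memberCells (I : Finset {A : Set Ω // MeasurableSet A}) :
    Measurable (memberCells I) := by
  classical
  refine measurable_pi_iff.2 fun A => measurable_to_bool ?_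
  convert A.1.2 using 1
  ext ω
  simp [memberCells]

lemma apply_eq_sum_memberCells (I : Finset {A : Set Ω // MeasurableSet A}) (A : I)
    (x : Measure Ω) [Fintype (I → Bool)] :
    x A.1.1 = ∑ i : I → Bool, if i A then x (memberCells I ⁻¹' {i}) else 0 := by
  classical
  have h : A.1.1 = ⋃ i ∈ (univ : Finset (I → Bool)).filter (fun i => i A),
      memberCells I ⁻¹' {i} := by
    ext ω
    simp [memberCells]
  conv_lhs => rw [h]
  rw [measure_biUnion_finset, sum_filter]
  · intro i _ j _ hij
    exact Disjoint.preimage _ (by simpa using hij)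
  · exact fun i _ => measurable_memberCells I (measurableSet_singleton i)

/-- The value on finitely many sets, as a function of the values on the cells they generate. -/
noncomputable def sumCells (I : Finset {A : Set Ω // MeasurableSet A}) [Fintype (I → Bool)]
    (v : (I → Bool) → ℝ≥0∞) (A : I) : ℝ≥0∞ :=
  ∑ i : I → Bool, if i A then v i else 0

lemma measurable_sumCells (I : Finset {A : Set Ω // MeasurableSet A}) [Fintype (I → Bool)] :
    Measurable (sumCells I) :=
  measurable_pi_iff.2 fun A => Finset.measurable_sum _ fun i _ => by
    split_ifs <;> fun_prop

lemma restrict_evalAll (I : Finset {A : Set Ω // MeasurableSet A}) [Fintype (I → Bool)]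
    (x : Measure Ω) :
    I.restrict (evalAll x) = sumCells I fun i => x (memberCells I ⁻¹' {i}) := by
  classical
  funext A
  exact apply_eq_sum_memberCells I A x

/-- The values of two measures on the cells of a partition. -/
def pairCells {κ : Type*} (a : Ω → κ) (z : Measure Ω × Measure Ω) : κ ⊕ κ → ℝ≥0∞ :=
  Sum.elim (fun i => z.1 (a ⁻¹' {i})) fun i => z.2 (a ⁻¹' {i})

lemma measurable_pairCells {κ : Type*} [MeasurableSpace κ] [MeasurableSingletonClass κ]
    {a : Ω → κ} (ha : Measurable a) : Measurable (pairCells a) := by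
  refine measurable_pi_iff.2 ?_
  rintro (i | i)
  · exact (Measure.measurable_coe (ha (measurableSet_singleton i))).comp measurable_fst
  · exact (Measure.measurable_coe (ha (measurableSet_singleton i))).comp measurable_snd

/-- The law of a pair of random measures is determined by its values on finite partitions. -/
lemma ext_of_pairCells {μ ν : Measure (Measure Ω × Measure Ω)} [IsFiniteMeasure μ]
    (h : ∀ (κ : Type u) [Fintype κ] [MeasurableSpace κ] [MeasurableSingletonClass κ] (a : Ω → κ),
      Measurable a → μ.map (pairCells a) = ν.map (pairCells a)) : μ = ν := by
  classical
  set T := {A : Set Ω // MeasurableSet A}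
  let Φ : Measure Ω × Measure Ω → T → ℝ≥0∞ × ℝ≥0∞ := fun z A => (evalAll z.1 A, evalAll z.2 A)
  have hΦ : Measurable Φ := measurable_pi_iff.2 fun A =>
    ((Measure.measurable_coe A.2).comp measurable_fst).prodMk
      ((Measure.measurable_coe A.2).comp measurable_snd)
  have hle : (inferInstance : MeasurableSpace (Measure Ω × Measure Ω)) ≤
      MeasurableSpace.comap Φ inferInstance := by
    refine sup_le ?_ ?_
    · rw [← comap_evalAll, MeasurableSpace.comap_comp]
      refine Measurable.comap_le (@measurable_pi_lambda _ _ _ (MeasurableSpace.comap Φ _) _ _ ?_)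
      exact fun A => (measurable_fst.comp (measurable_pi_apply A) :
        Measurable fun f : T → ℝ≥0∞ × ℝ≥0∞ => (f A).1).comp (comap_measurable Φ)
    · rw [← comap_evalAll, MeasurableSpace.comap_comp]
      refine Measurable.comap_le (@measurable_pi_lambda _ _ _ (MeasurableSpace.comap Φ _) _ _ ?_)
      exact fun A => (measurable_snd.comp (measurable_pi_apply A) :
        Measurable fun f : T → ℝ≥0∞ × ℝ≥0∞ => (f A).2).comp (comap_measurable Φ)
  have hmap : μ.map Φ = ν.map Φ := by
    -- A law on the space of all evaluations is determined by its finite-dimensional marginals;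
    -- values on finitely many sets are sums over the cells these sets generate.
    refine IsProjectiveLimit.unique (P := fun I => (μ.map Φ).map I.restrict) (fun I => rfl)
      fun I => ?_
    have key : ∀ ρ : Measure (Measure Ω × Measure Ω), (ρ.map Φ).map I.restrict =
        (ρ.map (pairCells (memberCells I))).map fun v A =>
          (sumCells I (fun i => v (.inl i)) A, sumCells I (fun i => v (.inr i)) A) := by
      intro ρ
      have hm : Measurable fun (v : (I → Bool) ⊕ (I → Bool) → ℝ≥0∞) A =>
          (sumCells I (fun i => v (.inl i)) A, sumCells I (fun i => v (.inr i)) A) :=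
        measurable_pi_iff.2 fun A =>
          (((measurable_pi_apply A).comp (measurable_sumCells I)).comp (by fun_prop)).prodMk
            (((measurable_pi_apply A).comp (measurable_sumCells I)).comp (by fun_prop))
      rw [Measure.map_map (Finset.measurable_restrict I) hΦ,
        Measure.map_map hm (measurable_pairCells (measurable_memberCells I))]
      congr 1
      funext z A
      exact Prod.ext (congrFun (restrict_evalAll I z.1) A) (congrFun (restrict_evalAll I z.2) A)
    beta_reduce
    rw [key ν, key μ, h (I → Bool) _ (measurable_memberCells I)]
  refine Measure.ext fun s hs => ?_
  obtain ⟨t, ht, rfl⟩ := hle s hs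
  rw [← Measure.map_apply hΦ ht, hmap, Measure.map_apply hΦ ht]

/-- An event about almost surely integer values splits over the integer vectors. -/
lemma measure_preimage_eq_tsum {T ι : Type*} [MeasurableSpace T] [Fintype ι] (μ : Measure T)
    {g : T → ι → ℝ≥0∞} (hg : Measurable g) (hn : ∀ᵐ t ∂μ, ∀ i, ∃ k : ℕ, g t i = (k : ℝ≥0∞))
    (B : Set (ι → ℝ≥0∞)) :
    μ (g ⁻¹' B) = ∑' b : ι → ℕ, {b : ι → ℕ | (fun i => (b i : ℝ≥0∞)) ∈ B}.indicator
      (fun b => μ {t | ∀ i, g t i = b i}) b := by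
  classical
  have hm : ∀ b : ι → ℕ, MeasurableSet {t | ∀ i, g t i = b i} := fun b => by
    simp only [Set.ofPred_forall]
    exact MeasurableSet.iInter fun i => (measurable_pi_iff.1 hg i) (measurableSet_singleton _)
  have h1 : μ (g ⁻¹' B) = μ (⋃ b : ι → ℕ,
      if (fun i => (b i : ℝ≥0∞)) ∈ B then {t | ∀ i, g t i = b i} else ∅) := by
    refine measure_congr ?_
    filter_upwards [hn] with t ht
    choose k hk using ht
    refine propext ?_
    change t ∈ g ⁻¹' B ↔ t ∈ ⋃ b : ι → ℕ,
      if (fun i => (b i : ℝ≥0∞)) ∈ B then {t | ∀ i, g t i = b i} else ∅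
    simp only [Set.mem_preimage, Set.mem_iUnion]
    constructor
    · intro h
      refine ⟨k, ?_⟩
      rw [if_pos (by rwa [← funext hk])]
      exact hk
    · rintro ⟨b, hb⟩
      split_ifs at hb with h
      · rwa [funext hb]
      · exact hb.elim
  rw [h1, measure_iUnion]
  · refine tsum_congr fun b => ?_
    by_cases h : (fun i => (b i : ℝ≥0∞)) ∈ B
    · rw [if_pos h, Set.indicator_of_mem (by exact h)]
    · rw [if_neg h, Set.indicator_of_notMem (by exact h), measure_empty]
  · intro b b' hbb
    refine Set.disjoint_left.2 fun t ht ht' => hbb ?_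
    beta_reduce at ht ht'
    split_ifs at ht ht'
    · funext i
      exact_mod_cast (ht i).symm.trans (ht' i)
    all_goals first | exact ht.elim | exact ht'.elim
  · intro b
    split_ifs
    exacts [hm b, MeasurableSet.empty]

end Evaluation

/-! ### The atomwise law as a conditional law -/

section AtomwiseKernel

universe u

variable {Ω : Type u} [MeasurableSpace Ω] [StandardBorelSpace Ω]

open Classical in
/-- The atomwise law of a count measure, and the point mass at `0` for other measures. -/
noncomputable def atomwiseFun (Q : Set Ω → ℕ → Measure ℕ) [∀ A k, IsProbabilityMeasure (Q A k)]
    (x : Measure Ω) : Measure (Measure Ω) :=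
  if IsCount x then atomwiseLaw (fun ω k => Q {ω} k) x else Measure.dirac 0

variable (Q : Set Ω → ℕ → Measure ℕ) [∀ A k, IsProbabilityMeasure (Q A k)]

instance (x : Measure Ω) : IsProbabilityMeasure (atomwiseFun Q x) := by
  unfold atomwiseFun
  split_ifs with h
  exacts [h.isProbabilityMeasure_atomwiseLaw _, inferInstance]

lemma ae_atomwiseFun (x : Measure Ω) {κ : Type*} [Fintype κ] [MeasurableSpace κ]
    [MeasurableSingletonClass κ] {a : Ω → κ} (ha : Measurable a) :
    ∀ᵐ y ∂(atomwiseFun Q x), ∀ i, ∃ k : ℕ, y (a ⁻¹' {i}) = (k : ℝ≥0∞) := by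
  unfold atomwiseFun
  split_ifs with h
  · exact h.ae_atomwiseLaw _ ha
  · rw [ae_dirac_iff]
    · exact fun i => ⟨0, by simp⟩
    · simp only [Set.ofPred_forall]
      exact MeasurableSet.iInter fun i =>
        Measure.measurable_coe (ha (measurableSet_singleton i)) measurableSet_natCast

variable {Q}
variable (hQ0 : ∀ A, Q A 0 = Measure.dirac 0)
  (hQc : ∀ (A : ℕ → Set Ω) (ω : Ω), Antitone A → (∀ n, MeasurableSet (A n)) →
    ⋂ n, A n = {ω} → ∀ k l, Tendsto (fun n => Q (A n) k {l}) atTop (𝓝 (Q {ω} k {l})))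

include hQ0 hQc

/-- The atoms of x vary with x, so measurability is obtained indirectly: the cell approximations
depend on finitely many cell masses and converge pointwise. -/
lemma measurable_atomwiseFun_cells {κ : Type*} [Fintype κ] [MeasurableSpace κ]
    [MeasurableSingletonClass κ] {a : Ω → κ} (ha : Measurable a) (b : κ → ℕ) :
    Measurable fun x => atomwiseFun Q x {y | ∀ i, y (a ⁻¹' {i}) = b i} := by
  classical
  refine measurable_of_tendsto_metrizable (f := fun n x => if IsCount x then cellApprox Q a n x b
    else (Measure.dirac (0 : Measure Ω)) {y | ∀ i, y (a ⁻¹' {i}) = b i}) (fun n => ?_) ?_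
  · exact Measurable.ite measurableSet_isCount (measurable_cellApprox Q ha n b) measurable_const
  · refine tendsto_pi_nhds.2 fun x => ?_
    unfold atomwiseFun
    by_cases h : IsCount x
    · simp only [if_pos h]
      exact h.tendsto_cellApprox Q hQ0 hQc ha b
    · simp only [if_neg h]
      exact tendsto_const_nhds

/-- It suffices to treat cylinders. Each is an event about integer cell masses, so its probability
is a countable sum of functions already known to be measurable. -/
lemma measurable_atomwiseFun : Measurable (atomwiseFun Q) := by
  classical
  refine Measurable.measure_of_isPiSystem_of_isProbabilityMeasure
    (S := {s | ∃ t ∈ measurableCylinders fun _ : {A : Set Ω // MeasurableSet A} => ℝ≥0∞,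
      evalAll ⁻¹' t = s}) ?_ (isPiSystem_measurableCylinders.comap _) ?_
  · rw [← comap_evalAll, ← generateFrom_measurableCylinders, MeasurableSpace.comap_generateFrom]
    rfl
  · rintro _ ⟨t, ht, rfl⟩
    obtain ⟨I, B, hB, rfl⟩ := (mem_measurableCylinders _).1 ht
    have hset : evalAll ⁻¹' cylinder I B = (fun (y : Measure Ω) i => y (memberCells I ⁻¹' {i})) ⁻¹'
        (sumCells I ⁻¹' B) := by
      ext y
      simp only [Set.mem_preimage, mem_cylinder]
      rw [restrict_evalAll]
    have hm : Measurable fun (y : Measure Ω) i => y (memberCells I ⁻¹' {i}) :=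
      measurable_pi_iff.2 fun i =>
        Measure.measurable_coe (measurable_memberCells I (measurableSet_singleton i))
    simp only [hset]
    simp only [fun x => measure_preimage_eq_tsum (atomwiseFun Q x) hm
      (ae_atomwiseFun Q x (measurable_memberCells I)) (sumCells I ⁻¹' B)]
    refine Measurable.tsum fun b => ?_
    by_cases h : b ∈ {b : (I → Bool) → ℕ | (fun i => (b i : ℝ≥0∞)) ∈ sumCells I ⁻¹' B}
    · simp only [Set.indicator_of_mem h]
      exact measurable_atomwiseFun_cells hQ0 hQc (measurable_memberCells I) b
    · simp only [Set.indicator_of_notMem h]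
      exact measurable_const

end AtomwiseKernel

/-! ### A criterion for conditional laws -/

section Criterion

universe u

variable {Ω : Type u} [MeasurableSpace Ω] {S : Type*} [MeasurableSpace S] {P : Measure S}
  {U V : S → Measure Ω} {Q : Set Ω → ℕ → Measure ℕ}

/-- On the cells of every finite partition, the counts of `V` are independent given those of `U`,
and the count of `V` in a cell has law `Q` given that of `U`. -/
def HasCellLaws (V U : S → Measure Ω) (Q : Set Ω → ℕ → Measure ℕ) (P : Measure S) : Prop :=
  ∀ (κ : Type u) [Fintype κ] [MeasurableSpace κ] [MeasurableSingletonClass κ] (a : Ω → κ),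
    Measurable a → ∃ w : (κ → ℕ) → ℝ≥0∞, ∀ m b : κ → ℕ,
      P {s | ∀ i, U s (a ⁻¹' {i}) = m i ∧ V s (a ⁻¹' {i}) = b i} =
        w m * ∏ i, Q (a ⁻¹' {i}) (m i) {b i}

/-- All masses of measurable sets are integers. -/
def IsNatValued (x : Measure Ω) : Prop := ∀ A, MeasurableSet A → ∃ k : ℕ, x A = k

lemma IsNatValued.natFloor {x : Measure Ω} (hx : IsNatValued x) {A : Set Ω}
    (hA : MeasurableSet A) : x A = ⌊(x A).toReal⌋₊ := by
  obtain ⟨k, hk⟩ := hx A hA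
  simp [hk]

lemma natFloor_eq_iff {x : Measure Ω} (hx : IsNatValued x) {A : Set Ω}
    (hA : MeasurableSet A) (k : ℕ) : ⌊(x A).toReal⌋₊ = k ↔ x A = k := by
  rw [hx.natFloor hA]
  simp

/-- The weight `w` in `HasCellLaws` need not be identified in advance: summing over the counts of
`V` forces it to be the mass function of the counts of `U`. -/
lemma map_cellCounts_eq_compProd [IsProbabilityMeasure P]
    [∀ A k, IsProbabilityMeasure (Q A k)] (hU : Measurable U) (hV : Measurable V)
    (hUn : ∀ s, IsNatValued (U s)) (hVn : ∀ s, IsNatValued (V s)) (h : HasCellLaws V U Q P)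
    {C : Type u} [Fintype C] [MeasurableSpace C] [MeasurableSingletonClass C] {c : Ω → C}
    (hc : Measurable c) :
    P.map (fun s => (cellCounts c (U s), cellCounts c (V s))) =
      P.map (fun s => cellCounts c (U s)) ⊗ₘ cellKernel Q c := by
  obtain ⟨w, hw⟩ := h C c hc
  have hmU : Measurable fun s => cellCounts c (U s) := (measurable_cellCounts hc).comp hU
  have hmV : Measurable fun s => cellCounts c (V s) := (measurable_cellCounts hc).comp hV
  have hsingle : ∀ m b : C → ℕ, P.map (fun s => (cellCounts c (U s), cellCounts c (V s))) {(m, b)} =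
      w m * cellKernel Q c m {b} := by
    intro m b
    rw [Measure.map_apply (hmU.prodMk hmV) (measurableSet_singleton _), cellKernel_apply,
      Measure.pi_singleton, ← hw]
    congr 1
    ext s
    simp only [Set.mem_preimage, Set.mem_singleton_iff, Prod.mk.injEq, funext_iff, cellCounts,
      natFloor_eq_iff (hUn s) (hc (measurableSet_singleton _)),
      natFloor_eq_iff (hVn s) (hc (measurableSet_singleton _)), Set.mem_ofPred_eq, forall_and]
  have hfst : ∀ m : C → ℕ, P.map (fun s => cellCounts c (U s)) {m} = w m := by
    intro m
    have h1 : P.map (fun s => cellCounts c (U s)) =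
        (P.map (fun s => (cellCounts c (U s), cellCounts c (V s)))).map Prod.fst := by
      rw [Measure.map_map measurable_fst (hmU.prodMk hmV)]
      rfl
    have h2 : Prod.fst ⁻¹' {m} = ⋃ b : C → ℕ, {(m, b)} := by
      ext ⟨x, y⟩
      simp [eq_comm]
    rw [h1, Measure.map_apply measurable_fst (measurableSet_singleton _), h2, measure_iUnion]
    · simp only [hsingle, ENNReal.tsum_mul_left]
      have h3 : ∑' b : C → ℕ, cellKernel Q c m {b} = 1 := by
        rw [← measure_univ (μ := cellKernel Q c m), ← Set.iUnion_of_singleton (C → ℕ),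
          measure_iUnion]
        · intro b b' hb
          simpa using hb
        · exact fun b => measurableSet_singleton b
      rw [h3, mul_one]
    · intro b b' hb
      simpa using hb
    · exact fun b => measurableSet_singleton _
  refine Measure.ext_of_singleton fun ⟨m, b⟩ => ?_
  rw [hsingle, ← Set.singleton_prod_singleton, Measure.compProd_apply_prod
    (measurableSet_singleton _) (measurableSet_singleton _), lintegral_singleton, hfst, mul_comm]

variable [StandardBorelSpace Ω]

lemma IsNatValued.isCount {x : Measure Ω} (hx : IsNatValued x) : IsCount x :=
  fun n v => hx _ (measurable_prefixCode n (measurableSet_singleton v))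

omit [StandardBorelSpace Ω] in
lemma measure_cell_eq_sum {κ B : Type*} [Fintype B] [MeasurableSpace κ]
    [MeasurableSingletonClass κ] [MeasurableSpace B] [MeasurableSingletonClass B] {x : Measure Ω}
    (hx : IsNatValued x) {a : Ω → κ} {v : Ω → B} (ha : Measurable a) (hv : Measurable v) (i : κ) :
    x (a ⁻¹' {i}) = ((∑ w, cellCounts (fun ω => (a ω, v ω)) x (i, w) : ℕ) : ℝ≥0∞) := by
  have hm : ∀ w, MeasurableSet ((fun ω => (a ω, v ω)) ⁻¹' {(i, w)}) := fun w =>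
    (ha.prodMk hv) (by rw [← Set.singleton_prod_singleton]; exact
      (measurableSet_singleton _).prod (measurableSet_singleton _))
  have h : a ⁻¹' {i} = ⋃ w ∈ (univ : Finset B), (fun ω => (a ω, v ω)) ⁻¹' {(i, w)} := by
    ext ω
    simp
  rw [h, measure_biUnion_finset, Nat.cast_sum]
  · exact sum_congr rfl fun w _ => hx.natFloor (hm w)
  · intro w _ w' _ hw
    exact Disjoint.preimage _ (by simpa using hw)
  · exact fun w _ => hm w

/-- The joint law on a partition, computed from the law on a refinement. -/
lemma measure_cells_eq_lintegral_cellApprox [IsProbabilityMeasure P]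
    [∀ A k, IsProbabilityMeasure (Q A k)] (hU : Measurable U) (hV : Measurable V)
    (hUn : ∀ s, IsNatValued (U s)) (hVn : ∀ s, IsNatValued (V s)) (h : HasCellLaws V U Q P)
    {κ : Type u} [Fintype κ] [MeasurableSpace κ] [MeasurableSingletonClass κ] {a : Ω → κ}
    (ha : Measurable a) (m b : κ → ℕ) (n : ℕ) :
    P {s | ∀ i, U s (a ⁻¹' {i}) = m i ∧ V s (a ⁻¹' {i}) = b i} =
      ∫⁻ s, {s | ∀ i, U s (a ⁻¹' {i}) = m i}.indicator (fun s => cellApprox Q a n (U s) b) s ∂P := by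
  classical
  set c := refineCells a n
  have hc : Measurable c := measurable_refineCells ha n
  have hmU : Measurable fun s => cellCounts c (U s) := (measurable_cellCounts hc).comp hU
  have hmV : Measurable fun s => cellCounts c (V s) := (measurable_cellCounts hc).comp hV
  have hsum : ∀ {x : Measure Ω}, IsNatValued x → ∀ (k : κ → ℕ),
      (∀ i, x (a ⁻¹' {i}) = k i) ↔ ∀ i, ∑ w, cellCounts c x (i, w) = k i := by
    intro x hx k
    refine forall_congr' fun i => ?_
    rw [measure_cell_eq_sum hx ha (measurable_prefixCode n) i, Nat.cast_inj]
    rfl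
  let E : Set ((κ × (Fin n → Bool) → ℕ) × (κ × (Fin n → Bool) → ℕ)) :=
    {z | (∀ i, ∑ w, z.1 (i, w) = m i) ∧ ∀ i, ∑ w, z.2 (i, w) = b i}
  have h1 : {s | ∀ i, U s (a ⁻¹' {i}) = m i ∧ V s (a ⁻¹' {i}) = b i} =
      (fun s => (cellCounts c (U s), cellCounts c (V s))) ⁻¹' E := by
    ext s
    simp only [Set.mem_ofPred_eq, forall_and, hsum (hUn s), hsum (hVn s), Set.mem_preimage, E]
  have hE : MeasurableSet E := (Set.to_countable E).measurableSet
  rw [h1, ← Measure.map_apply (hmU.prodMk hmV) hE,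
    map_cellCounts_eq_compProd hU hV hUn hVn h hc, Measure.compProd_apply hE,
    lintegral_map (measurable_of_countable _) hmU]
  refine lintegral_congr fun s => ?_
  by_cases hs : ∀ i, U s (a ⁻¹' {i}) = m i
  · rw [Set.indicator_of_mem (by exact hs), cellApprox]
    congr 1
    ext v
    simp only [Set.mem_preimage, Set.mem_ofPred_eq, E, (hsum (hUn s) m).1 hs]
    simp
  · rw [Set.indicator_of_notMem (by exact hs)]
    have : Prod.mk (cellCounts c (U s)) ⁻¹' E = ∅ := by
      ext v
      simp only [Set.mem_preimage, Set.mem_ofPred_eq, E, ← hsum (hUn s) m, hs]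
      simp
    rw [this, measure_empty]

lemma cellApprox_le_one [∀ A k, IsProbabilityMeasure (Q A k)] {κ : Type*} [Fintype κ]
    [MeasurableSpace κ] [MeasurableSingletonClass κ] (a : Ω → κ) (n : ℕ) (x : Measure Ω)
    (b : κ → ℕ) : cellApprox Q a n x b ≤ 1 := prob_le_one

/-- If the laws on all finite partitions are given by `Q`, and `Q` on small sets approaches `Q` on
points, then `V` has the atomwise law given `U`. -/
theorem hasCondLaw_atomwiseLaw [IsProbabilityMeasure P]
    [∀ A k, IsProbabilityMeasure (Q A k)] (hU : Measurable U) (hV : Measurable V)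
    (hUn : ∀ s, IsNatValued (U s)) (hVn : ∀ s, IsNatValued (V s)) (h : HasCellLaws V U Q P)
    (hQ0 : ∀ A, Q A 0 = Measure.dirac 0)
    (hQc : ∀ (A : ℕ → Set Ω) (ω : Ω), Antitone A → (∀ n, MeasurableSet (A n)) →
      ⋂ n, A n = {ω} → ∀ k l, Tendsto (fun n => Q (A n) k {l}) atTop (𝓝 (Q {ω} k {l}))) :
    HasCondLaw V U (atomwiseLaw fun ω k => Q {ω} k) P := by
  let K : Kernel (Measure Ω) (Measure Ω) := ⟨atomwiseFun Q, measurable_atomwiseFun hQ0 hQc⟩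
  have : IsMarkovKernel K := ⟨fun x => inferInstanceAs (IsProbabilityMeasure (atomwiseFun Q x))⟩
  have hK : ∀ x, IsCount x → K x = atomwiseLaw (fun ω k => Q {ω} k) x := fun x hx => if_pos hx
  have hPU : IsProbabilityMeasure (P.map U) := Measure.isProbabilityMeasure_map hU.aemeasurable
  refine ⟨K, ?_, ⟨(hU.prodMk hV).aemeasurable, ?_⟩⟩
  · have : ∀ᵐ x ∂(P.map U), IsCount x :=
      (ae_map_iff hU.aemeasurable measurableSet_isCount).2 (ae_of_all _ fun s => (hUn s).isCount)
    filter_upwards [this] with x hx using hK x hx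
  have hPUV : IsProbabilityMeasure (P.map fun s => (U s, V s)) :=
    Measure.isProbabilityMeasure_map (hU.prodMk hV).aemeasurable
  refine ext_of_pairCells fun κ _ _ _ a ha => Measure.ext fun B hB => ?_
  have hcell : ∀ i, MeasurableSet (a ⁻¹' {i}) := fun i => ha (measurableSet_singleton i)
  have hmp := measurable_pairCells ha
  have hnat : MeasurableSet
      {z : Measure Ω × Measure Ω | ∀ i, ∃ k : ℕ, pairCells a z i = (k : ℝ≥0∞)} := by
    simp only [Set.ofPred_forall]
    exact MeasurableSet.iInter fun i => (measurable_pi_iff.1 hmp i) measurableSet_natCast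
  rw [Measure.map_apply hmp hB, Measure.map_apply hmp hB, measure_preimage_eq_tsum _ hmp,
    measure_preimage_eq_tsum _ hmp]
  · refine tsum_congr fun b => ?_
    congr 1
    funext b
    have hset : {z : Measure Ω × Measure Ω | ∀ i, pairCells a z i = b i} =
        {z | ∀ i, z.1 (a ⁻¹' {i}) = (b (.inl i) : ℝ≥0∞) ∧ z.2 (a ⁻¹' {i}) = (b (.inr i) : ℝ≥0∞)} := by
      ext z
      simp [pairCells, forall_and]
    have hmeas : MeasurableSet
        {z : Measure Ω × Measure Ω | ∀ i, z.1 (a ⁻¹' {i}) = (b (.inl i) : ℝ≥0∞) ∧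
          z.2 (a ⁻¹' {i}) = (b (.inr i) : ℝ≥0∞)} := by
      have e : {z : Measure Ω × Measure Ω | ∀ i, z.1 (a ⁻¹' {i}) = (b (.inl i) : ℝ≥0∞) ∧
          z.2 (a ⁻¹' {i}) = (b (.inr i) : ℝ≥0∞)} =
          {x : Measure Ω | ∀ i, x (a ⁻¹' {i}) = (b (.inl i) : ℝ≥0∞)} ×ˢ
            {x : Measure Ω | ∀ i, x (a ⁻¹' {i}) = (b (.inr i) : ℝ≥0∞)} := by
        ext z
        simp [forall_and]
      rw [e]
      exact (measurableSet_cell_eq ha _).prod (measurableSet_cell_eq ha _)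
    rw [hset, Measure.map_apply (hU.prodMk hV) hmeas, Measure.compProd_apply hmeas,
      lintegral_map (Kernel.measurable_kernel_prodMk_left hmeas) hU]
    have hmU : MeasurableSet {s | ∀ i, U s (a ⁻¹' {i}) = (b (.inl i) : ℝ≥0∞)} :=
      hU (measurableSet_cell_eq ha fun i => b (.inl i))
    -- The left side does not depend on the refinement level n, so it equals the limit of the right
    -- sides, computed by dominated convergence with bound 1.
    have hexact := measure_cells_eq_lintegral_cellApprox hU hV hUn hVn h ha
      (fun i => b (.inl i)) (fun i => b (.inr i))
    have hlim := tendsto_lintegral_of_dominated_convergence (μ := P)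
      (F := fun n s => {s | ∀ i, U s (a ⁻¹' {i}) = (b (.inl i) : ℝ≥0∞)}.indicator
        (fun s => cellApprox Q a n (U s) fun i => b (.inr i)) s)
      (f := fun s => K (U s) (Prod.mk (U s) ⁻¹' {z : Measure Ω × Measure Ω |
        ∀ i, z.1 (a ⁻¹' {i}) = (b (.inl i) : ℝ≥0∞) ∧ z.2 (a ⁻¹' {i}) = (b (.inr i) : ℝ≥0∞)}))
      (fun _ => 1)
      (fun n => ((measurable_cellApprox Q ha n _).comp hU).indicator hmU)
      (fun n => ae_of_all _ fun s => Set.indicator_le' (fun _ _ => cellApprox_le_one a n _ _)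
        (fun _ _ => zero_le) s) (by simp) (ae_of_all _ fun s => ?_)
    · refine tendsto_nhds_unique (tendsto_const_nhds.congr hexact) hlim
    · by_cases hs : ∀ i, U s (a ⁻¹' {i}) = (b (.inl i) : ℝ≥0∞)
      · simp only [Set.indicator_of_mem (show s ∈ {s | ∀ i, U s (a ⁻¹' {i}) = (b (.inl i) : ℝ≥0∞)} from hs)]
        have hpre : Prod.mk (U s) ⁻¹' {z : Measure Ω × Measure Ω |
            ∀ i, z.1 (a ⁻¹' {i}) = (b (.inl i) : ℝ≥0∞) ∧
              z.2 (a ⁻¹' {i}) = (b (.inr i) : ℝ≥0∞)} =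
            {y | ∀ i, y (a ⁻¹' {i}) = (b (.inr i) : ℝ≥0∞)} := by
          ext y
          simp [hs]
        rw [hK _ (hUn s).isCount, hpre]
        exact (hUn s).isCount.tendsto_cellApprox Q hQ0 hQc ha fun i => b (.inr i)
      · simp only [Set.indicator_of_notMem
          (show s ∉ {s | ∀ i, U s (a ⁻¹' {i}) = (b (.inl i) : ℝ≥0∞)} from hs)]
        have : Prod.mk (U s) ⁻¹' {z : Measure Ω × Measure Ω |
            ∀ i, z.1 (a ⁻¹' {i}) = (b (.inl i) : ℝ≥0∞) ∧ z.2 (a ⁻¹' {i}) = (b (.inr i) : ℝ≥0∞)} = ∅ := by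
          ext y
          simp only [Set.mem_preimage, Set.mem_ofPred_eq, Set.mem_empty_iff_false, iff_false]
          exact fun h => hs fun i => (h i).1
        rw [this, measure_empty]
        exact tendsto_const_nhds
  · have hx : ∀ᵐ x ∂(P.map U), ∀ i, ∃ k : ℕ, x (a ⁻¹' {i}) = (k : ℝ≥0∞) := by
      refine (ae_map_iff hU.aemeasurable ?_).2 (ae_of_all _ fun s i => hUn s _ (hcell i))
      simp only [Set.ofPred_forall]
      exact MeasurableSet.iInter fun i => Measure.measurable_coe (hcell i) measurableSet_natCast
    rw [Measure.ae_compProd_iff hnat]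
    filter_upwards [hx] with x hx
    filter_upwards [ae_atomwiseFun Q x ha] with y hy
    rintro (i | i)
    · exact hx i
    · exact hy i
  · rw [ae_map_iff (hU.prodMk hV).aemeasurable hnat]
    refine ae_of_all _ fun s => ?_
    rintro (i | i)
    · exact hUn s _ (hcell i)
    · exact hVn s _ (hcell i)

end Criterion

/-! ### Both constructions depend only on the joint law -/

section Laws

universe u

variable {Ω : Type u} [MeasurableSpace Ω] {S S' : Type*} [MeasurableSpace S] [MeasurableSpace S']
  {P : Measure S} {P' : Measure S'} [IsProbabilityMeasure P] [IsProbabilityMeasure P']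

omit [IsProbabilityMeasure P] in
lemma IsCompletelyRandom.iIndepFun_cells {X : S → Measure Ω} {marg : Set Ω → Measure ℕ}
    (h : IsCompletelyRandom X marg P) {κ : Type*} [Fintype κ] [MeasurableSpace κ]
    [MeasurableSingletonClass κ] {a : Ω → κ} (ha : Measurable a) :
    iIndepFun (fun i s => X s (a ⁻¹' {i})) P := by
  let e := Fintype.equivFin κ
  have := (h.indep _ (fun j => a ⁻¹' {e.symm j}) (fun j => ha (measurableSet_singleton _))
    fun i j hij => Disjoint.preimage _ (by simpa using hij)).precomp e.injective
  simpa using this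

lemma IsCompletelyRandom.map_cells {X : S → Measure Ω} {marg : Set Ω → Measure ℕ}
    (h : IsCompletelyRandom X marg P) {κ : Type*} [Fintype κ] [MeasurableSpace κ]
    [MeasurableSingletonClass κ] {a : Ω → κ} (ha : Measurable a) :
    P.map (fun s i => X s (a ⁻¹' {i})) =
      Measure.pi fun i => (marg (a ⁻¹' {i})).map fun n : ℕ => (n : ℝ≥0∞) := by
  have hm : ∀ i, Measurable fun s => X s (a ⁻¹' {i}) := fun i =>
    (Measure.measurable_coe (ha (measurableSet_singleton i))).comp h.measurable
  rw [(iIndepFun_iff_map_fun_eq_pi_map fun i => (hm i).aemeasurable).1 (h.iIndepFun_cells ha)]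
  congr 1
  funext i
  exact h.map_eval _ (ha (measurableSet_singleton i))

-- The diagonal pair allows `ext_of_pairCells` to be used for a single random measure.
omit [IsProbabilityMeasure P] in
lemma map_diag_pairCells {X : S → Measure Ω} (hX : Measurable X) {κ : Type*} [MeasurableSpace κ]
    [MeasurableSingletonClass κ] {a : Ω → κ} (ha : Measurable a) :
    ((P.map X).map fun x => (x, x)).map (pairCells a) =
      (P.map fun s i => X s (a ⁻¹' {i})).map fun v => Sum.elim v v := by
  have hdiag : Measurable fun x : Measure Ω => (x, x) := measurable_id.prodMk measurable_id
  have hXi : Measurable fun s i => X s (a ⁻¹' {i}) := measurable_pi_iff.2 fun i =>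
    (Measure.measurable_coe (ha (measurableSet_singleton i))).comp hX
  have hm : Measurable fun (v : κ → ℝ≥0∞) => (Sum.elim v v : κ ⊕ κ → ℝ≥0∞) := by
    refine measurable_pi_iff.2 ?_
    rintro (i | i) <;> exact measurable_pi_apply i
  rw [Measure.map_map hdiag hX, Measure.map_map (measurable_pairCells ha) (hdiag.comp hX),
    Measure.map_map hm hXi]
  rfl

/-- The law of a completely random measure is determined by the laws of its values. -/
lemma IsCompletelyRandom.map_eq {X : S → Measure Ω} {X' : S' → Measure Ω}
    {marg : Set Ω → Measure ℕ} (h : IsCompletelyRandom X marg P)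
    (h' : IsCompletelyRandom X' marg P') : P.map X = P'.map X' := by
  have hdiag : Measurable fun x : Measure Ω => (x, x) := measurable_id.prodMk measurable_id
  have hprob : IsProbabilityMeasure (P.map X) :=
    Measure.isProbabilityMeasure_map h.measurable.aemeasurable
  have : IsProbabilityMeasure ((P.map X).map fun x => (x, x)) :=
    Measure.isProbabilityMeasure_map hdiag.aemeasurable
  have key : (P.map X).map (fun x => (x, x)) = (P'.map X').map fun x => (x, x) := by
    refine ext_of_pairCells fun κ _ _ _ a ha => ?_
    rw [map_diag_pairCells h.measurable ha, map_diag_pairCells h'.measurable ha, h.map_cells ha,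
      h'.map_cells ha]
  have := congrArg (Measure.map Prod.fst) key
  rw [Measure.map_map measurable_fst hdiag, Measure.map_map measurable_fst hdiag] at this
  simpa [Function.comp_def] using this

lemma IsCompletelyRandom.of_map_eq {X : S → Measure Ω} {X' : S' → Measure Ω}
    {marg : Set Ω → Measure ℕ} (h : IsCompletelyRandom X marg P) (hX' : Measurable X')
    (heq : P.map X = P'.map X') : IsCompletelyRandom X' marg P' where
  measurable := hX'
  map_eval A hA := by
    have hm : Measurable fun x : Measure Ω => x A := Measure.measurable_coe hA
    rw [← h.map_eval A hA]
    exact ((Measure.map_map hm hX').symm.trans (by rw [heq])).trans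
      (Measure.map_map hm h.measurable)
  indep n A hA hd := by
    have hm : Measurable fun (x : Measure Ω) i => x (A i) :=
      measurable_pi_iff.2 fun i => Measure.measurable_coe (hA i)
    have hmi : ∀ i, Measurable fun x : Measure Ω => x (A i) := fun i => Measure.measurable_coe (hA i)
    have h1 := (iIndepFun_iff_map_fun_eq_pi_map
      fun i => ((hmi i).comp h.measurable).aemeasurable).1 (h.indep n A hA hd)
    refine (iIndepFun_iff_map_fun_eq_pi_map fun i => ((hmi i).comp hX').aemeasurable).2 ?_
    have e1 : P'.map (fun s i => X' s (A i)) = P.map fun s i => X s (A i) :=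
      ((Measure.map_map hm hX').symm.trans (by rw [heq])).trans (Measure.map_map hm h.measurable)
    have e2 : ∀ i, P'.map (fun s => X' s (A i)) = P.map fun s => X s (A i) := fun i =>
      ((Measure.map_map (hmi i) hX').symm.trans (by rw [heq])).trans
        (Measure.map_map (hmi i) h.measurable)
    refine (e1.trans h1).trans ?_
    congr 1
    funext i
    exact (e2 i).symm

section CondLaw

variable {𝓧 𝓨 : Type*} [MeasurableSpace 𝓧] [MeasurableSpace 𝓨] {X : S → 𝓧} {Y : S → 𝓨}
  {X' : S' → 𝓧} {Y' : S' → 𝓨} {κ : 𝓧 → Measure 𝓨}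

/-- Composition with a kernel that is not s-finite is 0 by convention, whereas the joint law has
mass 1. -/
lemma isSFiniteKernel_of_hasCondDistrib {K : Kernel 𝓧 𝓨} (h : HasCondDistrib Y X K P) :
    IsSFiniteKernel K := by
  by_contra hK
  have hprob : IsProbabilityMeasure (P.map fun s => (X s, Y s)) :=
    Measure.isProbabilityMeasure_map h.aemeasurable
  have h0 := h.map_eq
  rw [Measure.compProd_of_not_isSFiniteKernel _ _ hK] at h0
  exact IsProbabilityMeasure.ne_zero _ h0

/-- The joint law is determined by a marginal law and the conditional law. -/
lemma HasCondLaw.map_prod_eq (h : HasCondLaw Y X κ P) (h' : HasCondLaw Y' X' κ P')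
    (heq : P.map X = P'.map X') :
    P.map (fun s => (X s, Y s)) = P'.map fun s => (X' s, Y' s) := by
  obtain ⟨K, hK, hl⟩ := h
  obtain ⟨K', hK', hl'⟩ := h'
  have := isSFiniteKernel_of_hasCondDistrib hl
  have := isSFiniteKernel_of_hasCondDistrib hl'
  rw [hl.map_eq, hl'.map_eq, ← heq]
  rw [← heq] at hK'
  refine Measure.compProd_congr ?_
  filter_upwards [hK, hK'] with x hx hx'
  rw [hx, hx']

omit [IsProbabilityMeasure P] [IsProbabilityMeasure P'] in
lemma HasCondLaw.of_map_eq (h : HasCondLaw Y X κ P) (hX : Measurable X) (hY : Measurable Y)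
    (hX' : Measurable X') (hY' : Measurable Y')
    (heq : P.map (fun s => (X s, Y s)) = P'.map fun s => (X' s, Y' s)) :
    HasCondLaw Y' X' κ P' := by
  obtain ⟨K, hK, hl⟩ := h
  have hfst : P.map X = P'.map X' := by
    have := congrArg (Measure.map Prod.fst) heq
    rw [Measure.map_map measurable_fst (hX.prodMk hY),
      Measure.map_map measurable_fst (hX'.prodMk hY')] at this
    exact this
  refine ⟨K, hfst ▸ hK, ⟨(hX'.prodMk hY').aemeasurable, ?_⟩⟩
  rw [← heq, ← hfst]
  exact hl.map_eq

end CondLaw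

end Laws

/-! ### The constructed pair satisfies both descriptions -/

section Constructed

variable {Ω : Type*} [MeasurableSpace Ω] (G₀ : Measure Ω) [IsFiniteMeasure G₀]
  (p : Set.Ioo (0 : ℝ) 1)

lemma tsum_measure_singleton_nat (μ : Measure ℕ) [IsProbabilityMeasure μ] :
    ∑' k, μ {k} = 1 := by
  have h := measure_iUnion (μ := μ) (f := fun k : ℕ => ({k} : Set ℕ))
    (fun i j hij => by simpa using hij) fun k => measurableSet_singleton k
  rw [Set.iUnion_of_singleton, measure_univ] at h
  exact h.symm

/-- Applied to the two factorizations of the joint mass function, this yields the Poisson marginal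
of the tables and the negative binomial marginal of the customers. -/
lemma map_eq_of_joint_singleton {S : Type*} [MeasurableSpace S] {P : Measure S} {Z W : S → ℕ}
    (hZ : Measurable Z) (hW : Measurable W) {α : Measure ℕ} {ν : ℕ → Measure ℕ}
    [∀ k, IsProbabilityMeasure (ν k)] (h : ∀ z w, P {s | Z s = z ∧ W s = w} = α {z} * ν z {w}) :
    P.map Z = α := by
  refine Measure.ext_of_singleton fun z => ?_
  have hset : Z ⁻¹' {z} = ⋃ w, {s | Z s = z ∧ W s = w} := by
    ext s
    simp
  rw [Measure.map_apply hZ (measurableSet_singleton _), hset, measure_iUnion]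
  · simp only [h, ENNReal.tsum_mul_left, tsum_measure_singleton_nat, mul_one]
  · intro w w' hw
    exact Set.disjoint_left.2 fun s hs hs' => hw (hs.2.symm.trans hs'.2)
  · exact fun w => (hZ (measurableSet_singleton z)).inter (hW (measurableSet_singleton w))

lemma counts_singleton {A : Set Ω} (hA : MeasurableSet A) (m l : ℕ) :
    restaurantSample G₀ p {s | counts A s = (m, l)} =
      poissonMeasure (logRate p * (G₀ A).toNNReal) {l} * sumLogMeasure p l {m} := by
  classical
  have ha : Measurable fun ω => decide (ω ∈ A) := measurable_to_bool (by
    convert hA using 1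
    ext ω
    simp)
  have hpre : (fun ω => decide (ω ∈ A)) ⁻¹' {true} = A := by
    ext ω
    simp
  have := (counts_indep G₀ p ha).2 true m l
  rwa [hpre] at this

lemma map_counts_snd {A : Set Ω} (hA : MeasurableSet A) :
    (restaurantSample G₀ p).map (fun s => (counts A s).2) =
      poissonMeasure (logRate p * (G₀ A).toNNReal) :=
  map_eq_of_joint_singleton (W := fun s => (counts A s).1) (measurable_counts hA).snd
    (measurable_counts hA).fst (ν := fun l => sumLogMeasure p l) fun l m => by
      rw [← counts_singleton G₀ p hA]
      congr 1
      ext s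
      simp [Prod.ext_iff, and_comm]

lemma map_counts_fst {A : Set Ω} (hA : MeasurableSet A) :
    (restaurantSample G₀ p).map (fun s => (counts A s).1) = nbMeasure (G₀ A).toNNReal p :=
  map_eq_of_joint_singleton (W := fun s => (counts A s).2) (measurable_counts hA).fst
    (measurable_counts hA).snd (ν := fun m => crtMeasure m (G₀ A).toNNReal) fun m l => by
      rw [← poisson_mul_sumLog_eq_nb_mul_crt, ← counts_singleton G₀ p hA]
      congr 1
      ext s
      simp [Prod.ext_iff]

lemma iIndepFun_counts {n : ℕ} {A : Fin n → Set Ω} (hA : ∀ i, MeasurableSet (A i))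
    (hd : Pairwise (Function.onFun Disjoint A)) :
    iIndepFun (fun i => counts (A i)) (restaurantSample G₀ p) := by
  classical
  -- Disjoint sets become fibers of one map, with `none` collecting the rest of Ω; the results on
  -- partitions then apply.
  let a : Ω → Option (Fin n) := fun ω => if h : ∃ i, ω ∈ A i then some h.choose else none
  have hpre : ∀ i, a ⁻¹' {some i} = A i := by
    intro i
    ext ω
    simp only [Set.mem_preimage, Set.mem_singleton_iff, a]
    split_ifs with h
    · rw [Option.some_inj]
      refine ⟨fun hi => hi ▸ h.choose_spec, fun hi => ?_⟩
      by_contra hne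
      exact Set.disjoint_left.1 (hd hne) h.choose_spec hi
    · simp only [false_iff]
      exact fun hi => h ⟨i, hi⟩
  let : MeasurableSpace (Option (Fin n)) := ⊤
  have : MeasurableSingletonClass (Option (Fin n)) := ⟨fun _ => trivial⟩
  have ha : Measurable a := by
    refine measurable_to_countable' fun i => ?_
    cases i with
    | some i => rw [hpre]; exact hA i
    | none =>
      have : a ⁻¹' {none} = (⋃ i, A i)ᶜ := by
        ext ω
        simp [a]
      rw [this]
      exact (MeasurableSet.iUnion hA).compl
  have := (counts_indep G₀ p ha).1.precomp (Option.some_injective (Fin n))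
  simpa only [hpre] using this

lemma isPoissonProcess_tableMeasure :
    IsPoissonProcess tableMeasure (ENNReal.ofReal (-Real.log (1 - p)) • G₀)
      (restaurantSample G₀ p) where
  measurable := measurable_tableMeasure
  map_eval A hA := by
    have hr : ((ENNReal.ofReal (-Real.log (1 - p)) • G₀) A).toNNReal =
        logRate p * (G₀ A).toNNReal := by
      rw [Measure.smul_apply, smul_eq_mul, ENNReal.toNNReal_mul]
      rfl
    rw [hr, ← map_counts_snd G₀ p hA, Measure.map_map (measurable_of_countable _)
      (measurable_counts hA).snd]
    congr 1
    funext s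
    exact tableMeasure_apply hA s
  indep n A hA hd := by
    have := (iIndepFun_counts G₀ p hA hd).comp (fun _ x => (x.2 : ℝ≥0∞))
      fun _ => measurable_of_countable _
    convert this using 2 with i
    funext s
    exact tableMeasure_apply (hA i) s

lemma isNBProcess_customerMeasure :
    IsNBProcess customerMeasure G₀ p (restaurantSample G₀ p) where
  measurable := measurable_customerMeasure
  map_eval A hA := by
    rw [← map_counts_fst G₀ p hA, Measure.map_map (measurable_of_countable _)
      (measurable_counts hA).fst]
    congr 1
    funext s
    exact customerMeasure_apply hA s
  indep n A hA hd := by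
    have := (iIndepFun_counts G₀ p hA hd).comp (fun _ x => (x.1 : ℝ≥0∞))
      fun _ => measurable_of_countable _
    convert this using 2 with i
    funext s
    exact customerMeasure_apply (hA i) s

lemma isNatValued_customerMeasure (s : Sample (Ω × ℕ)) : IsNatValued (customerMeasure s) :=
  fun _ hA => ⟨_, customerMeasure_apply hA s⟩

lemma isNatValued_tableMeasure (s : Sample (Ω × ℕ)) : IsNatValued (tableMeasure s) :=
  fun _ hA => ⟨_, tableMeasure_apply hA s⟩

variable [StandardBorelSpace Ω]

lemma isSumLog_restaurantSample :
    IsSumLog customerMeasure tableMeasure p (restaurantSample G₀ p) := by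
  refine ⟨measurable_customerMeasure, hasCondLaw_atomwiseLaw (Q := fun _ l => sumLogMeasure p l)
    measurable_tableMeasure measurable_customerMeasure isNatValued_tableMeasure
    isNatValued_customerMeasure ?_ (fun _ => sumLogMeasure_zero p)
    fun _ _ _ _ _ _ _ => tendsto_const_nhds⟩
  intro κ _ _ _ a ha
  refine ⟨fun l => ∏ i, poissonMeasure (logRate p * (G₀ (a ⁻¹' {i})).toNNReal) {l i},
    fun l m => ?_⟩
  rw [← prod_mul_distrib, ← customerMeasure_tableMeasure_singleton G₀ p ha]
  simp only [and_comm]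

/-- The cell law uses the mass of G₀ on the whole cell as concentration. As cells shrink to ω this
tends to G₀({ω}), and CRT is continuous in its concentration. -/
lemma isCRTP_restaurantSample :
    IsCRTP tableMeasure customerMeasure G₀ (restaurantSample G₀ p) := by
  refine ⟨measurable_tableMeasure, hasCondLaw_atomwiseLaw
    (Q := fun A m => crtMeasure m (G₀ A).toNNReal)
    measurable_customerMeasure measurable_tableMeasure isNatValued_customerMeasure
    isNatValued_tableMeasure ?_ (fun _ => crtMeasure_zero _) ?_⟩
  · intro κ _ _ _ a ha
    refine ⟨fun m => ∏ i, nbMeasure (G₀ (a ⁻¹' {i})).toNNReal p {m i}, fun m l => ?_⟩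
    rw [← prod_mul_distrib, customerMeasure_tableMeasure_singleton G₀ p ha]
    exact prod_congr rfl fun i _ => poisson_mul_sumLog_eq_nb_mul_crt _ _ _ _
  · intro A ω hanti hA hinter k l
    refine tendsto_crtMeasure ?_ k l
    have h := tendsto_measure_iInter_atTop (μ := G₀) (fun n => (hA n).nullMeasurableSet) hanti
      ⟨0, measure_ne_top _ _⟩
    rw [hinter] at h
    exact (ENNReal.tendsto_toNNReal (measure_ne_top _ _)).comp h

variable {G₀ p} {S : Type*} [MeasurableSpace S] {P : Measure S} [IsProbabilityMeasure P]
  {X L : S → Measure Ω}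

/-- The law of L and the conditional law of X given L determine the law of (L, X); swapping
coordinates gives that of (X, L). -/
lemma IsCompoundPoissonPair.map_eq (h : IsCompoundPoissonPair X L G₀ p P) :
    P.map (fun s => (X s, L s)) =
      (restaurantSample G₀ p).map fun s => (customerMeasure s, tableMeasure s) := by
  have h1 := h.1.2.map_prod_eq (isSumLog_restaurantSample G₀ p).2
    (IsCompletelyRandom.map_eq h.2 (isPoissonProcess_tableMeasure G₀ p))
  have h2 := congrArg (Measure.map Prod.swap) h1
  rwa [Measure.map_map measurable_swap (h.2.measurable.prodMk h.1.1),
    Measure.map_map measurable_swap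
      (measurable_tableMeasure.prodMk measurable_customerMeasure)] at h2

lemma IsNBRestaurantPair.map_eq (h : IsNBRestaurantPair X L G₀ p P) :
    P.map (fun s => (X s, L s)) =
      (restaurantSample G₀ p).map fun s => (customerMeasure s, tableMeasure s) :=
  h.1.2.map_prod_eq (isCRTP_restaurantSample G₀ p).2
    (IsCompletelyRandom.map_eq h.2 (isNBProcess_customerMeasure G₀ p))

section OfMap

variable (hX : Measurable X) (hL : Measurable L)
  (h : P.map (fun s => (X s, L s)) =
    (restaurantSample G₀ p).map fun s => (customerMeasure s, tableMeasure s))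

include hX hL h

lemma isCompoundPoissonPair_of_map_eq : IsCompoundPoissonPair X L G₀ p P := by
  have hswap : (restaurantSample G₀ p).map (fun s => (tableMeasure s, customerMeasure s)) =
      P.map fun s => (L s, X s) := by
    have h2 := congrArg (Measure.map Prod.swap) h.symm
    rwa [Measure.map_map measurable_swap
      (measurable_customerMeasure.prodMk measurable_tableMeasure),
      Measure.map_map measurable_swap (hX.prodMk hL)] at h2
  refine ⟨⟨hX, (isSumLog_restaurantSample G₀ p).2.of_map_eq measurable_tableMeasure
    measurable_customerMeasure hL hX hswap⟩,
    IsCompletelyRandom.of_map_eq (isPoissonProcess_tableMeasure G₀ p) hL ?_⟩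
  have h3 := congrArg (Measure.map Prod.fst) hswap
  rwa [Measure.map_map measurable_fst (measurable_tableMeasure.prodMk measurable_customerMeasure),
    Measure.map_map measurable_fst (hL.prodMk hX)] at h3

lemma isNBRestaurantPair_of_map_eq : IsNBRestaurantPair X L G₀ p P := by
  refine ⟨⟨hL, (isCRTP_restaurantSample G₀ p).2.of_map_eq measurable_customerMeasure
    measurable_tableMeasure hX hL h.symm⟩,
    IsCompletelyRandom.of_map_eq (isNBProcess_customerMeasure G₀ p) hX ?_⟩
  have h3 := congrArg (Measure.map Prod.fst) h.symm
  rwa [Measure.map_map measurable_fst (measurable_customerMeasure.prodMk measurable_tableMeasure),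
    Measure.map_map measurable_fst (hX.prodMk hL)] at h3

end OfMap

end Constructed

end NBProcess

/-! ### Existence, equivalence and uniqueness in law -/

theorem mainTheorem4 {Ω : Type*} [MeasurableSpace Ω] [StandardBorelSpace Ω]
    (G₀ : Measure Ω) [IsFiniteMeasure G₀] (p : Set.Ioo (0 : ℝ) 1) :
    -- the compound Poisson construction exists
    (∃ P : Measure (Measure Ω × Measure Ω), IsProbabilityMeasure P ∧
      NBProcess.IsCompoundPoissonPair Prod.fst Prod.snd G₀ p P) ∧
    -- a pair arises from one construction exactly when it arises from the other
    (∀ {S : Type*} [MeasurableSpace S] (P : Measure S) [IsProbabilityMeasure P]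
      (X L : S → Measure Ω),
      NBProcess.IsCompoundPoissonPair X L G₀ p P ↔ NBProcess.IsNBRestaurantPair X L G₀ p P) ∧
    -- any realizations of the two constructions have the same joint distribution
    (∀ {S S' : Type*} [MeasurableSpace S] [MeasurableSpace S']
      (P : Measure S) [IsProbabilityMeasure P] (P' : Measure S') [IsProbabilityMeasure P']
      (X L : S → Measure Ω) (X' L' : S' → Measure Ω),
      NBProcess.IsCompoundPoissonPair X L G₀ p P → NBProcess.IsNBRestaurantPair X' L' G₀ p P' →
      IdentDistrib (fun s => (X s, L s)) (fun s => (X' s, L' s)) P P') := by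
  refine ⟨?_, ?_, ?_⟩
  · have hm := (NBProcess.measurable_customerMeasure (Ω := Ω)).prodMk
      NBProcess.measurable_tableMeasure
    have hP : IsProbabilityMeasure ((NBProcess.restaurantSample G₀ p).map
        fun s => (NBProcess.customerMeasure s, NBProcess.tableMeasure s)) :=
      Measure.isProbabilityMeasure_map hm.aemeasurable
    -- The canonical realization: the law of the constructed pair on the product space, with the
    -- coordinate projections as X and L.
    refine ⟨_, hP, NBProcess.isCompoundPoissonPair_of_map_eq measurable_fst measurable_snd ?_⟩
    exact Measure.map_id
  · intro S _ P _ X L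
    exact ⟨fun h => NBProcess.isNBRestaurantPair_of_map_eq h.1.1 h.2.measurable h.map_eq,
      fun h => NBProcess.isCompoundPoissonPair_of_map_eq h.2.measurable h.1.1 h.map_eq⟩
  · intro S S' _ _ P _ P' _ X L X' L' h h'
    exact ⟨(h.1.1.prodMk h.2.measurable).aemeasurable, (h'.2.measurable.prodMk h'.1.1).aemeasurable,
      h.map_eq.trans h'.map_eq.symm⟩
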